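/- **Setting.** A $T$-group is a finitely generated torsion-free nilpotent group. The Hirsch length of a polycyclic group is the number of infinite factors in a subnormal series with cyclic factors. For $n\in\mathbb N$ and $t=(t_{i,j,k}\mid 1\le i<j<k\le n)\in\mathbb Z^{\binom n3}$ let $$G(t)=\langle a_1,\dots,a_n \mid a_ja_i=a_ia_j\,a_{j+1}^{t_{i,j,j+1}}\cdots a_n^{t_{i,j,n}}\ (1\le i<j\le n)\rangle ,$$ and let $\mathcal C_n$ be the set of all $t$ for which $G(t)$ has Hirsch length exactly $n$ (the consistent $t$). Let $T=(T_{i,j,k}\mid 1\le i<j<k\le n)$ be indeterminates, and write $T_u,T_v,T_w$ for the subfamilies of those $T_{i,j,k}$ with $i,j,k\ne 1$, respectively $\ne 2$, respectively $\ne n$ (the remaining indices being renumbered $1,\dots,n-1$). **The polynomials.** For a polynomial $g(z)=c_0+c_1z+\dots+c_lz^l$ over a commutative $\mathbb Q$-algebra let $$\Sigma_z\, g=\sum_{m=1}^{l+1}\Big(\sum_{k=0}^{l+1-m}\frac{c_{m+k-1}}{m+k}B_k\binom{m+k}{k}\Big)z^m ,$$ where $B_k$ are the Bernoulli numbers with $B_1=-\tfrac12$;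 so $f=\Sigma_z g$ satisfies $f(0)=0$ and $f(z+1)=f(z)+g(z)$. Define polynomials $F_i=F^{(n)}_i(T;x,y)$, $K_i=K^{(n)}_i(T;x,z)$ for $1\le i\le n$ and $R_{i,j,k}=R^{(n)}_{i,j,k}(T;u,v)$ for $1\le i<j<k\le n$, with coefficients in $\mathbb Q[T]$, where $x=(x_1,\dots,x_n)$, $y=(y_1,\dots,y_n)$, by the following induction on $n$. For $n\le2$ put $F_i=x_i+y_i$ and $K_i=x_iz$. Let $n\ge3$. For vectors $p,q$ of length $n-1$, indexed by $2,\dots,n$, write $p*q=F^{(n-1)}(T_u;p,q)$ and $p^{[c]}=K^{(n-1)}(T_u;p,c)$; products of several factors are formed from left to right. 1. *Conjugation.* $R_{i,j,k}$ is obtained from the polynomials for $n-1$ with the corresponding renumbered indices, at the parameters $T_w$ if $k<n$, at $T_u$ if $k=n$ and $i>1$, and at $T_v$ if $k=n$, $i=1$, $j>2$. For $R_{1,2,n}$, let $e_j$ (for $2\le j\le n$) be the vector with entries $0$ before position $j$, $1$ at $j$, and $T_{1,j,l}$ at $l>j$. Let $g(v)\in\mathbb Q[T][v]$ be the last entry of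 $e_2 * e_3^{[R_{1,2,3}(T;1,v)]} * \cdots * e_{n-1}^{[R_{1,2,n-1}(T;1,v)]}$, put $\rho(v)=\Sigma_v\,g$, and let $R_{1,2,n}(T;u,v)$ be the last entry of $r^{[u]}$, where $r=(1,R_{1,2,3}(T;1,v),\dots,R_{1,2,n-1}(T;1,v),\rho(v))$. 2. *Multiplication.* For $i<n$ put $F_i=F^{(n-1)}_i(T_w;(x_1,\dots,x_{n-1}),(y_1,\dots,y_{n-1}))$. For $2\le i\le n$ let $d_i$ be the vector with entries $0$ before position $i$, $x_i$ at $i$, and $R_{1,i,l}(T;x_i,y_1)$ at $l>i$; let $F_n$ be the last entry of $d_2*d_3*\cdots*d_n*(y_2,\dots,y_n)$. 3. *Powering.* For $i<n$ put $K_i=K^{(n-1)}_i(T_w;(x_1,\dots,x_{n-1}),z)$, and put $K_n=\Sigma_z\,h$ with $h(z)=F_n(T;(K_1,\dots,K_{n-1},0),x)$. **Statement.** Let $n\in\mathbb N$. (a) Every $T$-group of Hirsch length $n$ is isomorphic to $G(t)$ for some $t\in\mathcal C_n$. More precisely, if a group $G$ has a central series $G=G_1\ge\dots\ge G_{n+1}=\{1\}$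 with infinite cyclic factors and $g_iG_{i+1}$ generates $G_i/G_{i+1}$ for $1\le i\le n$, then there are $t\in\mathcal C_n$ and an isomorphism $G(t)\to G$ with $a_i\mapsto g_i$ for all $i$. (b) For every $t\in\mathcal C_n$, each element of $G(t)$ can be written uniquely as $a_1^{x_1}\cdots a_n^{x_n}$ with $x\in\mathbb Z^n$. For all $x,y\in\mathbb Z^n$ and $z,u,v\in\mathbb Z$ the values $F_i(t;x,y)$, $K_i(t;x,z)$ and $R_{i,j,k}(t;u,v)$ are integers, and in $G(t)$ $$(a_1^{x_1}\cdots a_n^{x_n})(a_1^{y_1}\cdots a_n^{y_n})=a_1^{F_1(t;x,y)}\cdots a_n^{F_n(t;x,y)},$$ $$(a_1^{x_1}\cdots a_n^{x_n})^z=a_1^{K_1(t;x,z)}\cdots a_n^{K_n(t;x,z)},$$ $$a_j^ua_i^v=a_i^va_j^u\,a_{j+1}^{R_{i,j,j+1}(t;u,v)}\cdots a_n^{R_{i,j,n}(t;u,v)}\qquad(1\le i<j\le n).$$ -/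

import Mathlib

open scoped Polynomial

noncomputable section

namespace HallPoly

/-! ### Groups: Hirsch length, nilpotent presentations -/

/-- A subnormal series `G = H 0 ≥ H 1 ≥ ⋯ ≥ H m = 1` with cyclic factors. -/
structure IsPolycyclicSeries {G : Type*} [Group G] {m : ℕ} (H : Fin (m + 1) → Subgroup G) :
    Prop where
  top : H 0 = ⊤
  bot : H (Fin.last m) = ⊥
  le : ∀ i : Fin m, H i.succ ≤ H i.castSucc
  cyclic : ∀ i : Fin m, ∃ _ : ((H i.succ).subgroupOf (H i.castSucc)).Normal,
    IsCyclic (H i.castSucc ⧸ (H i.succ).subgroupOf (H i.castSucc))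

/-- `G` is polycyclic and has Hirsch length `n`: it has a subnormal series with cyclic factors of
which exactly `n` are infinite. -/
def HasHirschLength (G : Type*) [Group G] (n : ℕ) : Prop :=
  ∃ (m : ℕ) (H : Fin (m + 1) → Subgroup G), IsPolycyclicSeries H ∧
    Nat.card {i : Fin m // Infinite (H i.castSucc ⧸ (H i.succ).subgroupOf (H i.castSucc))} = n

/-- A `T`-group: finitely generated, torsion-free and nilpotent. -/
structure IsTGroup (G : Type*) [Group G] : Prop where
  fg : Group.FG G
  nilpotent : Group.IsNilpotent G
  torsionFree : ∀ g : G, g ≠ 1 → ¬ IsOfFinOrder g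

/-- `G = H 0 ≥ H 1 ≥ ⋯ ≥ H n = 1` is a central series with infinite cyclic factors, and the coset
of `g i` generates the `i`-th factor. -/
structure IsCentralBasis {G : Type*} [Group G] {n : ℕ} (H : Fin (n + 1) → Subgroup G)
    (g : Fin n → G) : Prop where
  top : H 0 = ⊤
  bot : H (Fin.last n) = ⊥
  le : ∀ i : Fin n, H i.succ ≤ H i.castSucc
  central : ∀ i : Fin n, ⁅H i.castSucc, (⊤ : Subgroup G)⁆ ≤ H i.succ
  gen : ∀ i : Fin n, H i.castSucc = Subgroup.zpowers (g i) ⊔ H i.succ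
  infinite : ∀ i : Fin n, Infinite (H i.castSucc ⧸ (H i.succ).subgroupOf (H i.castSucc))

/-- The word `a_1 ^ x_1 ⋯ a_n ^ x_n`. -/
def normalWord {G : Type*} [Group G] {n : ℕ} (a : Fin n → G) (x : Fin n → ℤ) : G :=
  (List.ofFn fun i => a i ^ x i).prod

/-- The word `a_{j+1} ^ w_{j+1} ⋯ a_n ^ w_n`. -/
def tailWord {G : Type*} [Group G] {n : ℕ} (a : Fin n → G) (j : Fin n) (w : Fin n → ℤ) : G :=
  normalWord a fun k => if j < k then w k else 0

/-- Index triples `i < j < k`. (Indices are counted from `0`.) -/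
structure Triple (n : ℕ) : Type where
  i : Fin n
  j : Fin n
  k : Fin n
  lt₁ : i < j
  lt₂ : j < k

/-- The family `t_{i,j,k}` as a function of `k`, continued by `0` to `k ≤ j`. -/
def exps {A : Type*} [Zero A] {n : ℕ} (t : Triple n → A) {i j : Fin n} (h : i < j) (k : Fin n) :
    A :=
  if hk : j < k then t ⟨i, j, k, h, hk⟩ else 0

/-- The relators of the nilpotent presentation:
`a_j a_i = a_i a_j a_{j+1} ^ t_{i,j,j+1} ⋯ a_n ^ t_{i,j,n}` for `i < j`. -/
def relators {n : ℕ} (t : Triple n → ℤ) : Set (FreeGroup (Fin n)) :=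
  {r | ∃ (i j : Fin n) (h : i < j),
    r = (FreeGroup.of j * FreeGroup.of i) *
      (FreeGroup.of i * FreeGroup.of j * tailWord FreeGroup.of j (exps t h))⁻¹}

/-- The group `G(t)`. -/
abbrev NilGroup {n : ℕ} (t : Triple n → ℤ) : Type := PresentedGroup (relators t)

/-- The generators `a_i` of `G(t)`. -/
def gen {n : ℕ} (t : Triple n → ℤ) (i : Fin n) : NilGroup t := PresentedGroup.of i

/-- The set `C_n` of all `t` for which `G(t)` is consistent, i.e. has Hirsch length exactly `n`. -/
def consistentSet (n : ℕ) : Set (Triple n → ℤ) := {t | HasHirschLength (NilGroup t) n}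

/-! ### Polynomials with parameters -/

/-- The coefficient ring `ℚ[T]`. -/
abbrev QT (n : ℕ) : Type := MvPolynomial (Triple n) ℚ

/-- A collection of candidate polynomials: `F_i ∈ ℚ[T][x, y]`, `K_i ∈ ℚ[T][x][z]` and
`R_{i,j,k} ∈ ℚ[T][u, v]` (with `u`, `v` the variables `0`, `1`). -/
structure Polys (n : ℕ) : Type where
  F : Fin n → MvPolynomial (Fin n ⊕ Fin n) (QT n)
  K : Fin n → (MvPolynomial (Fin n) (QT n))[X]
  R : Triple n → MvPolynomial (Fin 2) (QT n)

section Eval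

variable {A : Type*} [CommRing A] [Algebra ℚ A] {n : ℕ}

/-- The substitution `T ↦ τ` on `ℚ[T]`. -/
def param (τ : Triple n → A) : QT n →+* A := (MvPolynomial.aeval τ : QT n →ₐ[ℚ] A).toRingHom

/-- `f(τ; x, y)` for `f ∈ ℚ[T][x, y]`. -/
def subsF (f : MvPolynomial (Fin n ⊕ Fin n) (QT n)) (τ : Triple n → A) (x y : Fin n → A) : A :=
  f.eval₂ (param τ) (Sum.elim x y)

/-- `f(τ; x, z)` for `f ∈ ℚ[T][x][z]`. -/
def subsK (f : (MvPolynomial (Fin n) (QT n))[X]) (τ : Triple n → A) (x : Fin n → A) (z : A) : A :=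
  f.eval₂ (MvPolynomial.eval₂Hom (param τ) x) z

/-- `f(τ; u, v)` for `f ∈ ℚ[T][u, v]`. -/
def subsR (f : MvPolynomial (Fin 2) (QT n)) (τ : Triple n → A) (u v : A) : A :=
  f.eval₂ (param τ) ![u, v]

/-- `F(τ; x, y) = (F_1(τ; x, y), …, F_n(τ; x, y))`. -/
def Polys.mul (D : Polys n) (τ : Triple n → A) (x y : Fin n → A) (i : Fin n) : A :=
  subsF (D.F i) τ x y

/-- `K(τ; x, z) = (K_1(τ; x, z), …, K_n(τ; x, z))`. -/
def Polys.pow (D : Polys n) (τ : Triple n → A) (x : Fin n → A) (z : A) (i : Fin n) : A :=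
  subsK (D.K i) τ x z

/-- `R_q(τ; u, v)` for a triple `q = (i, j, k)`. -/
def Polys.conj (D : Polys n) (τ : Triple n → A) (q : Triple n) (u v : A) : A :=
  subsR (D.R q) τ u v

end Eval

/-- The polynomial solution `f` of `f(0) = f₀`, `f(x + 1) = f(x) + g(x)`, through Bernoulli
numbers: `f_m = ∑_{k = 0}^{l + 1 - m} (c_{m+k-1} / (m + k)) B_k binom(m + k, k)` for
`1 ≤ m ≤ l + 1`, where `g = c_0 + ⋯ + c_l x ^ l`. -/
def solveRec {S : Type*} [CommRing S] [Algebra ℚ S] (f₀ : S) (g : S[X]) : S[X] :=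
  Polynomial.C f₀ + ∑ m ∈ Finset.Icc 1 (g.natDegree + 1), Polynomial.monomial m
    (∑ k ∈ Finset.range (g.natDegree + 2 - m),
      (bernoulli k * ((m + k).choose k : ℚ) / ((m + k : ℕ) : ℚ)) • g.coeff (m + k - 1))

/-! ### The inductive algorithm -/

/-- The case `n ≤ 2`, where `G(T)` is free abelian: `F_i = x_i + y_i`, `K_i = x_i z`.
(There are no triples then.) -/
def basePolys (n : ℕ) : Polys n where
  F i := MvPolynomial.X (Sum.inl i) + MvPolynomial.X (Sum.inr i)
  K i := Polynomial.C (MvPolynomial.X i) * Polynomial.X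
  R _ := 0

/-- The embedding of triples that skips the index `p`. -/
def Triple.skip {m : ℕ} (p : Fin (m + 1)) (q : Triple m) : Triple (m + 1) :=
  ⟨p.succAbove q.i, p.succAbove q.j, p.succAbove q.k,
    Fin.strictMono_succAbove p q.lt₁, Fin.strictMono_succAbove p q.lt₂⟩

section Step

/-! One step of the induction, from `m = k + 2` to `n = m + 1 = k + 3`. Every group element is
represented by its vector of exponents, with entries in a polynomial ring `A`. Elements of
`U = ⟨a_2, …, a_n⟩` have vectors indexed by `Fin m`, with the index shifted by one. -/

variable {k : ℕ} (D : Polys (k + 2))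

section Params

variable {A : Type*} (τ : Triple (k + 3) → A)

/-- The parameters of `U = ⟨a_2, …, a_n⟩`. -/
def paramU : Triple (k + 2) → A := fun q => τ (q.skip 0)

/-- The parameters of `V = ⟨a_1, a_3, …, a_n⟩`. -/
def paramV : Triple (k + 2) → A := fun q => τ (q.skip 1)

/-- The parameters of `W = G / ⟨a_n⟩`. -/
def paramW : Triple (k + 2) → A := fun q => τ (q.skip (Fin.last _))

end Params

section InRing

variable {A : Type*} [CommRing A] [Algebra ℚ A] (τ : Triple (k + 3) → A)

/-- The element `a_j ^ {a_1} = a_j a_{j+1} ^ T_{1,j,j+1} ⋯ a_n ^ T_{1,j,n}` of `U`. -/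
def conjGen (j : Fin (k + 2)) : Fin (k + 2) → A := fun l =>
  if l = j then 1 else exps τ (Fin.succ_pos j) l.succ

/-- `R_{1,2,j}(τ; 1, v)` for `3 ≤ j ≤ n - 1`, taken from `W`; `j` is shifted to start at `0`. -/
def lowR (v : A) (j : Fin k) : A :=
  D.conj (paramW τ) ⟨0, 1, j.succ.succ, by simp, by simp [Fin.lt_def]⟩ 1 v

/-- The exponents of
`a_2^{a_1} · ∏_{j = 3}^{n - 1} (a_j ^ {a_1}) ^ R_{1,2,j}(τ; 1, v)`, computed in `U`. -/
def stepProd (v : A) : Fin (k + 2) → A :=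
  (List.finRange k).foldl
    (fun w j => D.mul (paramU τ) w
      (D.pow (paramU τ) (conjGen τ j.succ.castSucc) (lowR D τ v j)))
    (conjGen τ 0)

end InRing

/-- `R_{1,2,n}(T; 1, v)` as an element of `ℚ[T][v]`, as the solution of
`R(T; 1, v + 1) = R(T; 1, v) + g(v)` with `R(T; 1, 0) = 0`. -/
def newROne : (QT (k + 3))[X] :=
  solveRec 0
    (stepProd D (fun q => Polynomial.C (MvPolynomial.X q)) Polynomial.X (Fin.last _))

/-- `R_{1,2,n}(T; u, v) = K_{n-1}(T_u; r, u)` with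
`r = (1, R_{1,2,3}(T; 1, v), …, R_{1,2,n}(T; 1, v))`. -/
def newR : MvPolynomial (Fin 2) (QT (k + 3)) :=
  let τ : Triple (k + 3) → MvPolynomial (Fin 2) (QT (k + 3)) :=
    fun q => MvPolynomial.C (MvPolynomial.X q)
  let u : MvPolynomial (Fin 2) (QT (k + 3)) := MvPolynomial.X 0
  let v : MvPolynomial (Fin 2) (QT (k + 3)) := MvPolynomial.X 1
  let r : Fin (k + 2) → MvPolynomial (Fin 2) (QT (k + 3)) :=
    Fin.cons 1 (Fin.snoc (lowR D τ v) ((newROne D).eval₂ MvPolynomial.C v))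
  D.pow (paramU τ) r u (Fin.last _)

/-- All conjugation polynomials: those with `k < n` come from `W`, of the others those with
`i > 1` from `U`, of the others those with `j > 2` from `V`, and `R_{1,2,n}` is the new one. -/
def stepR (q : Triple (k + 3)) : MvPolynomial (Fin 2) (QT (k + 3)) :=
  let τ : Triple (k + 3) → MvPolynomial (Fin 2) (QT (k + 3)) :=
    fun q => MvPolynomial.C (MvPolynomial.X q)
  let u : MvPolynomial (Fin 2) (QT (k + 3)) := MvPolynomial.X 0
  let v : MvPolynomial (Fin 2) (QT (k + 3)) := MvPolynomial.X 1
  if hk : q.k < Fin.last (k + 2) then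
    D.conj (paramW τ)
      ⟨q.i.castLT ((q.lt₁.trans q.lt₂).trans hk), q.j.castLT (q.lt₂.trans hk), q.k.castLT hk,
        q.lt₁, q.lt₂⟩ u v
  else if hi : 0 < q.i then
    D.conj (paramU τ)
      ⟨q.i.pred hi.ne', q.j.pred (hi.trans q.lt₁).ne', q.k.pred ((hi.trans q.lt₁).trans q.lt₂).ne',
        Fin.pred_lt_pred_iff.2 q.lt₁, Fin.pred_lt_pred_iff.2 q.lt₂⟩ u v
  else if hj : 1 < q.j then
    D.conj (paramV τ)
      ⟨0, q.j.pred ((Fin.zero_le q.i).trans_lt q.lt₁).ne',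
        q.k.pred ((Fin.zero_le q.j).trans_lt q.lt₂).ne',
        by
          simp only [Fin.lt_def, Fin.val_pred, Fin.val_zero, Fin.val_one] at hj ⊢
          omega,
        Fin.pred_lt_pred_iff.2 q.lt₂⟩ u v
  else newR D

/-- The exponents of the factor
`a_i ^ x_i a_{i+1} ^ R_{1,i,i+1}(T; x_i, y_1) ⋯ a_n ^ R_{1,i,n}(T; x_i, y_1)` of `U`, the
conjugate of `a_i ^ x_i` by `a_1 ^ y_1`, for `2 ≤ i ≤ n`. -/
def conjFactor (i : Fin (k + 2)) :
    Fin (k + 2) → MvPolynomial (Fin (k + 3) ⊕ Fin (k + 3)) (QT (k + 3)) := fun l =>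
  if l = i then MvPolynomial.X (Sum.inl i.succ)
  else exps
    (fun q => subsR (stepR D q) (fun q' => MvPolynomial.C (MvPolynomial.X q'))
      (MvPolynomial.X (Sum.inl i.succ)) (MvPolynomial.X (Sum.inr 0)))
    (Fin.succ_pos i) l.succ

/-- `F_n`: the last exponent of `(∏_{i = 2}^n (a_i ^ x_i) ^ {a_1 ^ y_1}) · a_2 ^ y_2 ⋯ a_n ^ y_n`,
computed in `U`. -/
def newF : MvPolynomial (Fin (k + 3) ⊕ Fin (k + 3)) (QT (k + 3)) :=
  let τ : Triple (k + 3) → MvPolynomial (Fin (k + 3) ⊕ Fin (k + 3)) (QT (k + 3)) :=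
    fun q => MvPolynomial.C (MvPolynomial.X q)
  D.mul (paramU τ)
    ((List.finRange (k + 1)).foldl (fun w i => D.mul (paramU τ) w (conjFactor D i.succ))
      (conjFactor D 0))
    (fun l => MvPolynomial.X (Sum.inr l.succ)) (Fin.last _)

/-- The multiplication polynomials: `F_1, …, F_{n-1}` come from `W`, and `F_n` is the new one. -/
def stepF : Fin (k + 3) → MvPolynomial (Fin (k + 3) ⊕ Fin (k + 3)) (QT (k + 3)) :=
  Fin.snoc
    (D.mul (paramW fun q => MvPolynomial.C (MvPolynomial.X q))
      (fun i => MvPolynomial.X (Sum.inl i.castSucc)) (fun i => MvPolynomial.X (Sum.inr i.castSucc)))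
    (newF D)

/-- The powering polynomials `K_1, …, K_{n-1}`, which come from `W`. -/
def lowK : Fin (k + 2) → (MvPolynomial (Fin (k + 3)) (QT (k + 3)))[X] :=
  D.pow (paramW fun q => Polynomial.C (MvPolynomial.C (MvPolynomial.X q)))
    (fun i => Polynomial.C (MvPolynomial.X i.castSucc)) Polynomial.X

/-- `K_n`, as the solution of `K_n(T; x, z + 1) = K_n(T; x, z) + h(z)` with `K_n(T; x, 0) = 0`.
Since `F_n(T; x, y) = x_n + y_n + H_n(T; x_1, …, x_{n-1}, y_1, …, y_{n-1})`, the polynomial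
`h(z) = x_n + H_n(T; K_1, …, K_{n-1}, x_1, …, x_{n-1})` is
`F_n(T; (K_1, …, K_{n-1}, 0), x)`. -/
def newK : (MvPolynomial (Fin (k + 3)) (QT (k + 3)))[X] :=
  solveRec 0
    (subsF (newF D) (fun q => Polynomial.C (MvPolynomial.C (MvPolynomial.X q)))
      (Fin.snoc (lowK D) 0) (fun i => Polynomial.C (MvPolynomial.X i)))

/-- The step of the induction from `n - 1` to `n`. -/
def stepPolys : Polys (k + 3) where
  F := stepF D
  K := Fin.snoc (lowK D) (newK D)
  R := stepR D

end Step

/-- The polynomials `F_i`, `K_i`, `R_{i,j,k}` produced by the inductive algorithm. -/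
def hallPolys : (n : ℕ) → Polys n
  | 0 => basePolys 0
  | 1 => basePolys 1
  | 2 => basePolys 2
  | k + 3 => stepPolys (hallPolys (k + 2))

/-- The parameter values `t`, read in `ℚ`. -/
def ratParam {n : ℕ} (t : Triple n → ℤ) : Triple n → ℚ := fun q => (t q : ℚ)

/-- An integer vector, read in `ℚ`. -/
def ratVec {n : ℕ} (x : Fin n → ℤ) : Fin n → ℚ := fun i => (x i : ℚ)

end HallPoly

end

open scoped Polynomial

noncomputable section

namespace HallPoly

/-! Consistency of `t` has to be turned into uniqueness of normal words. The relations make the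
subgroups generated by the tails of `a_1, …, a_n` a central series with cyclic factors
(`SatisfiesRelations.series`). The number of infinite factors does not depend on the series
(`HasHirschLength.unique`), so Hirsch length `n` forces all `n` factors to be infinite, and then
exponents are unique. Conversely, the relations of a group with a central basis can be read off from
its commutators, and uniqueness of its normal words makes the map from `G(t)` bijective
(`IsCentralBasis.exists_mulEquiv`). A `T`-group has a central basis because a torsion-free nilpotent
group with the maximal condition contains a nontrivial central element generating an isolated
subgroup (`exists_isolated_central`); one passes to the quotient and repeats.

For the polynomials, everything is proved for a sequence `a` that satisfies the relations and has
unique normal words (`IsMalcevBasis`), in every group at once. Deleting `a_1` or `a_2`, or factoring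
out the central element `a_n`, leaves such a sequence with one term less, so the induction
hypothesis supplies all exponents except the last ones in `R_{1,2,n}`, `F_n` and `K_n`. For `F_n`,
the product is collected in `⟨a_2, …, a_n⟩` after moving `a_1 ^ y_1` to the left. For `R_{1,2,n}(1,
v)` and `K_n`, passing from `v` to `v + 1`, respectively from `z` to `z + 1`, changes the last
exponent by a known polynomial, because `a_n` is central. An integer sequence with such a recursion
is given by the Bernoulli solution (`eq_eval₂_solveRec`). Integrality needs no separate argument:
the polynomial values are identified with exponents that exist in the group. -/

/-! ### Invariance of the Hirsch length -/

section Hirsch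

variable {G : Type*} [Group G]

/-- `a` generates `H` modulo `K`, a subgroup of `H` normal in `H`. -/
structure CyclicMod (H K : Subgroup G) (a : G) : Prop where
  le : K ≤ H
  conj : ∀ h ∈ H, ∀ k ∈ K, h * k * h⁻¹ ∈ K
  mem : a ∈ H
  gen : ∀ h ∈ H, ∃ c : ℤ, ∃ k ∈ K, h = a ^ c * k

namespace CyclicMod

variable {H K N : Subgroup G} {a b : G}

lemma pow_eq (h : CyclicMod H K a) {k : G} (hk : k ∈ K) (c d : ℤ) :
    ∃ k' ∈ K, (a ^ d * k) ^ c = a ^ (d * c) * k' := by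
  have key : ∀ x : G, (∃ k' ∈ K, x = a ^ d * k') → ∀ m : ℕ, ∃ k' ∈ K, x ^ m = a ^ (d * m) * k' := by
    rintro x ⟨k₀, hk₀, rfl⟩ m
    induction m with
    | zero => exact ⟨1, K.one_mem, by simp⟩
    | succ m ih =>
      obtain ⟨k', hk', e⟩ := ih
      refine ⟨(a ^ d)⁻¹ * k' * a ^ d * k₀, K.mul_mem ?_ hk₀, ?_⟩
      · simpa using h.conj ((a ^ d)⁻¹) (H.inv_mem (H.zpow_mem h.mem d)) k' hk'
      · rw [pow_succ, e]
        push_cast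
        rw [mul_add, zpow_add, mul_one]
        group
  obtain ⟨m, rfl | rfl⟩ := c.eq_nat_or_neg
  · simpa using key _ ⟨k, hk, rfl⟩ m
  · obtain ⟨k', hk', e⟩ := key _ ⟨k, hk, rfl⟩ m
    refine ⟨a ^ (d * m) * k'⁻¹ * (a ^ (d * m))⁻¹, ?_, ?_⟩
    · exact h.conj _ (H.zpow_mem h.mem _) _ (K.inv_mem hk')
    · rw [zpow_neg, zpow_natCast, e]
      simp only [mul_inv_rev, mul_neg, zpow_neg]
      group

lemma exists_pow_eq (h : CyclicMod H K a) {x : G} (hx : x ∈ H) :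
    ∃ d : ℤ, ∀ c : ℤ, ∃ k ∈ K, x ^ c = a ^ (d * c) * k := by
  obtain ⟨d, k, hk, rfl⟩ := h.gen x hx
  exact ⟨d, fun c => h.pow_eq hk c d⟩

lemma pow_mem_of_fin (h : CyclicMod H K a) {c : ℤ} (hc : a ^ c ∈ K) {x : G} (hx : x ∈ H) :
    x ^ c ∈ K := by
  obtain ⟨d, hd⟩ := h.exists_pow_eq hx
  obtain ⟨k, hk, e⟩ := hd c
  rw [e, mul_comm, zpow_mul]
  exact K.mul_mem (K.zpow_mem hc _) hk

lemma mem_of_pow_mem (h : CyclicMod H K a) (inf : ∀ c : ℤ, a ^ c ∈ K → c = 0) {x : G}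
    (hx : x ∈ H) {c : ℤ} (hc : c ≠ 0) (hxc : x ^ c ∈ K) : x ∈ K := by
  obtain ⟨d, hd⟩ := h.exists_pow_eq hx
  obtain ⟨k, hk, e⟩ := hd c
  have h0 : d * c = 0 := inf _ (by
    rw [e] at hxc
    exact (Subgroup.mul_mem_cancel_right K hk).1 hxc)
  have hd0 : d = 0 := (mul_eq_zero.1 h0).resolve_right hc
  obtain ⟨k, hk, e⟩ := hd 1
  simp only [hd0, zpow_one, zero_mul, zpow_zero, one_mul] at e
  exact e ▸ hk

/-- The factor induced on a subgroup is cyclic. -/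
lemma inf_left (h : CyclicMod H K a) (hN : N ≤ H) :
    ∃ b k : G, ∃ d : ℤ, k ∈ K ∧ b = a ^ d * k ∧ CyclicMod N (N ⊓ K) b := by
  -- The exponents of the cosets `a ^ c K` that meet `N`. A generator `d` of this subgroup of `ℤ`
  -- yields the generator `a ^ d * k` of `N` modulo `N ⊓ K`; this is the embedding of `N / (N ∩ K)`
  -- in `H / K`.
  let D : AddSubgroup ℤ :=
    { carrier := {c | ∃ k ∈ K, a ^ c * k ∈ N}
      zero_mem' := ⟨1, K.one_mem, by simp⟩
      add_mem' := by
        rintro x y ⟨k, hk, hx⟩ ⟨l, hl, hy⟩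
        refine ⟨(a ^ y)⁻¹ * k * a ^ y * l, K.mul_mem ?_ hl, ?_⟩
        · simpa using h.conj ((a ^ y)⁻¹) (H.inv_mem (H.zpow_mem h.mem y)) k hk
        · convert N.mul_mem hx hy using 1
          rw [zpow_add]; group
      neg_mem' := by
        rintro x ⟨k, hk, hx⟩
        refine ⟨a ^ x * k⁻¹ * (a ^ x)⁻¹, h.conj _ (H.zpow_mem h.mem _) _ (K.inv_mem hk), ?_⟩
        convert N.inv_mem hx using 1
        rw [zpow_neg]; group }
  obtain ⟨d, hd⟩ := Int.subgroup_cyclic D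
  have hdD : d ∈ D := hd ▸ AddSubgroup.mem_closure_singleton_self d
  obtain ⟨k, hk, hb⟩ := hdD
  refine ⟨a ^ d * k, k, d, hk, rfl, inf_le_left, ?_, hb, ?_⟩
  · intro x hx y hy
    exact ⟨N.mul_mem (N.mul_mem hx hy.1) (N.inv_mem hx), h.conj x (hN hx) y hy.2⟩
  · intro x hx
    obtain ⟨c, l, hl, rfl⟩ := h.gen x (hN hx)
    have hc : c ∈ D := ⟨l, hl, hx⟩
    rw [hd, AddSubgroup.mem_closure_singleton] at hc
    obtain ⟨e, rfl⟩ := hc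
    obtain ⟨k', hk', e'⟩ := h.pow_eq hk e d
    refine ⟨e, ((a ^ d * k) ^ e)⁻¹ * (a ^ (e • d) * l), ⟨?_, ?_⟩, by group⟩
    · exact N.mul_mem (N.inv_mem (N.zpow_mem hb e)) hx
    · rw [e', smul_eq_mul, mul_comm e d]
      have : (a ^ (d * e) * k')⁻¹ * (a ^ (d * e) * l) = k'⁻¹ * l := by group
      rw [this]
      exact K.mul_mem (K.inv_mem hk') hl

end CyclicMod

/-- `K` is normal in `H` with finite cyclic factor. -/
def FinCyclic (H K : Subgroup G) : Prop :=
  ∃ a, CyclicMod H K a ∧ ∃ c : ℤ, c ≠ 0 ∧ a ^ c ∈ K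

/-- `K` is normal in `H` with infinite cyclic factor. -/
def InfCyclic (H K : Subgroup G) : Prop :=
  ∃ a, CyclicMod H K a ∧ ∀ c : ℤ, a ^ c ∈ K → c = 0

lemma FinCyclic.inf_left {H K N : Subgroup G} (h : FinCyclic H K) (hN : N ≤ H) :
    FinCyclic N (N ⊓ K) := by
  obtain ⟨a, ha, c, hc, hac⟩ := h
  obtain ⟨b, k, d, hk, rfl, hb⟩ := ha.inf_left hN
  exact ⟨_, hb, c, hc, N.zpow_mem hb.mem c, ha.pow_mem_of_fin hac (hN hb.mem)⟩

/-- A subgroup of `ℤ` is infinite cyclic or trivial; `d = 0` is the trivial case. -/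
lemma InfCyclic.inf_left {H K N : Subgroup G} (h : InfCyclic H K) (hN : N ≤ H) :
    InfCyclic N (N ⊓ K) ∨ N ≤ K := by
  obtain ⟨a, ha, inf⟩ := h
  obtain ⟨b, k, d, hk, rfl, hb⟩ := ha.inf_left hN
  by_cases hd : d = 0
  · right
    intro x hx
    obtain ⟨c, l, hl, rfl⟩ := hb.gen x hx
    subst hd
    simp only [zpow_zero, one_mul]
    exact K.mul_mem (K.zpow_mem hk c) hl.2
  · left
    refine ⟨_, hb, fun c hc => ?_⟩
    obtain ⟨k', hk', e⟩ := ha.pow_eq hk c d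
    have := inf (d * c) ((Subgroup.mul_mem_cancel_right K hk').1 (e ▸ hc.2))
    exact (mul_eq_zero.1 this).resolve_left hd

/-- `H / N` is an infinite quotient of `H / K ≅ ℤ`, and proper quotients of `ℤ` are finite. -/
lemma InfCyclic.eq_of_le {H K N : Subgroup G} (hK : InfCyclic H K) (hN : InfCyclic H N)
    (h : K ≤ N) : K = N := by
  refine le_antisymm h fun y hy => ?_
  obtain ⟨a, ha, infa⟩ := hK
  obtain ⟨b, hb, infb⟩ := hN
  obtain ⟨c, k, hk, rfl⟩ := ha.gen y (hb.le hy)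
  by_cases hc : c = 0
  · simpa [hc] using hk
  have hac : a ^ c ∈ N := (Subgroup.mul_mem_cancel_right N (h hk)).1 hy
  have haN : a ∈ N := hb.mem_of_pow_mem infb ha.mem hc hac
  obtain ⟨e, k', hk', hbe⟩ := ha.gen b hb.mem
  have := infb 1 (by
    rw [zpow_one, hbe]
    exact N.mul_mem (N.zpow_mem haN e) (h hk'))
  omega

lemma FinCyclic.not_infCyclic_of_le {H K N : Subgroup G} (hK : FinCyclic H K)
    (hN : InfCyclic H N) : ¬ K ≤ N := by
  intro h
  obtain ⟨a, ha, c, hc, hac⟩ := hK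
  obtain ⟨b, hb, infb⟩ := hN
  exact hc (infb c (h (ha.pow_mem_of_fin hac hb.mem)))

/-- `H` has a subnormal series with cyclic factors of which `n` are infinite. -/
inductive Polycyclic : Subgroup G → ℕ → Prop
  | bot : Polycyclic ⊥ 0
  | fin {H K : Subgroup G} {n : ℕ} : FinCyclic H K → Polycyclic K n → Polycyclic H n
  | inf {H K : Subgroup G} {n : ℕ} : InfCyclic H K → Polycyclic K n → Polycyclic H (n + 1)

/-- A diamond argument as for Jordan–Hölder: if `K` is the next term of the series of `H`, the
induction hypothesis for `K` is applied to `K ⊓ N`, and one climbs from `N ⊓ K` to `N`. The factors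
`K / (K ⊓ N)` and `N / (N ⊓ K)` are of the same kind as `H / N` and `H / K`, unless an infinite one
collapses. A collapse either makes a finite factor of `H` infinite, which is impossible, or, when
both factors are infinite, forces `N = K`. -/
lemma Polycyclic.descend {H : Subgroup G} {n : ℕ} (h : Polycyclic H n) :
    ∀ N : Subgroup G, (FinCyclic H N → Polycyclic N n) ∧
      (InfCyclic H N → ∃ m, n = m + 1 ∧ Polycyclic N m) := by
  induction h with
  | bot =>
    refine fun N => ⟨fun ⟨a, ha, _⟩ => ?_, fun ⟨a, ha, hinf⟩ => ?_⟩
    · rw [le_bot_iff.1 ha.le]; exact .bot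
    · have := hinf 1 (by simp [Subgroup.mem_bot.1 ha.mem, N.one_mem])
      omega
  | @fin H K n hHK hK ih =>
    intro N
    have hKH : K ≤ H := let ⟨_, h, _⟩ := hHK; h.le
    refine ⟨fun hN => ?_, fun hN => ?_⟩ <;> have hNH : N ≤ H := (let ⟨_, h, _⟩ := hN; h.le)
    · exact .fin (hHK.inf_left hNH) (inf_comm K N ▸ (ih (K ⊓ N)).1 (hN.inf_left hKH))
    · obtain h | h := hN.inf_left hKH
      · obtain ⟨m, rfl, hm⟩ := (ih _).2 h
        exact ⟨m, rfl, .fin (hHK.inf_left hNH) (inf_comm K N ▸ hm)⟩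
      · exact absurd h (hHK.not_infCyclic_of_le hN)
  | @inf H K n hHK hK ih =>
    intro N
    have hKH : K ≤ H := let ⟨_, h, _⟩ := hHK; h.le
    refine ⟨fun hN => ?_, fun hN => ?_⟩ <;> have hNH : N ≤ H := (let ⟨_, h, _⟩ := hN; h.le)
    · obtain h | h := hHK.inf_left hNH
      · exact .inf h (inf_comm K N ▸ (ih (K ⊓ N)).1 (hN.inf_left hKH))
      · exact absurd h (hN.not_infCyclic_of_le hHK)
    · obtain h | h := hN.inf_left hKH
      · obtain ⟨m, rfl, hm⟩ := (ih _).2 h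
        refine ⟨m + 1, rfl, ?_⟩
        obtain h' | h' := hHK.inf_left hNH
        · exact .inf h' (inf_comm K N ▸ hm)
        · obtain rfl := hN.eq_of_le hHK h'
          exact hK
      · obtain rfl := hHK.eq_of_le hN h
        exact ⟨n, rfl, hK⟩

/-- Going down the first series, `descend` transports the second length to every term, until both
are compared at `⊥`. -/
lemma Polycyclic.unique {H : Subgroup G} {n m : ℕ} (h : Polycyclic H n) (h' : Polycyclic H m) :
    n = m := by
  induction h generalizing m with
  | bot =>
    generalize hB : (⊥ : Subgroup G) = B at h'
    induction h' with
    | bot => rfl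
    | fin h _ ih =>
      subst hB
      exact ih (le_bot_iff.1 (let ⟨_, h, _⟩ := h; h.le)).symm
    | inf h _ ih =>
      subst hB
      obtain ⟨a, ha, hinf⟩ := h
      have := hinf 1 (by rw [Subgroup.mem_bot.1 ha.mem, one_zpow]; exact Subgroup.one_mem _)
      omega
  | fin h _ ih => exact ih ((h'.descend _).1 h)
  | inf h _ ih =>
    obtain ⟨k, rfl, hk⟩ := (h'.descend _).2 h
    rw [ih hk]

/-! ### Finite generation of subgroups and the maximal condition -/

lemma Polycyclic.fg {H : Subgroup G} {n : ℕ} (h : Polycyclic H n) :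
    ∀ N ≤ H, N.FG := by
  -- `N` is generated by a single element together with `N ⊓ K`, which lies one step lower.
  have step : ∀ {H K : Subgroup G} {a : G}, CyclicMod H K a → (∀ N ≤ K, N.FG) →
      ∀ N ≤ H, N.FG := by
    intro H K a ha ih N hN
    obtain ⟨b, -, -, -, -, hb⟩ := ha.inf_left hN
    have : N = Subgroup.closure {b} ⊔ (N ⊓ K) := by
      refine le_antisymm (fun x hx => ?_) (sup_le ?_ inf_le_left)
      · obtain ⟨c, k, hk, rfl⟩ := hb.gen x hx
        exact Subgroup.mul_mem_sup (Subgroup.zpow_mem _ (Subgroup.mem_closure_singleton_self b) c) hk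
      · simpa using hb.mem
    rw [this]
    exact Subgroup.FG.sup ⟨{b}, by simp⟩ (ih _ inf_le_right)
  induction h with
  | bot => exact fun N hN => le_bot_iff.1 hN ▸ Subgroup.FG.bot
  | fin h _ ih => obtain ⟨a, ha, -⟩ := h; exact step ha ih
  | inf h _ ih => obtain ⟨a, ha, -⟩ := h; exact step ha ih

lemma wellFoundedGT_subgroup (h : ∀ N : Subgroup G, N.FG) : WellFoundedGT (Subgroup G) := by
  rw [wellFoundedGT_iff_monotone_chain_condition]
  intro f
  obtain ⟨S, hS⟩ := h (⨆ i, f i)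
  have : ∀ s ∈ S, ∃ i, s ∈ f i := fun s hs => by
    have : s ∈ ⨆ i, f i := hS ▸ Subgroup.subset_closure hs
    rwa [Subgroup.mem_iSup_of_directed f.monotone.directed_le] at this
  choose! i hi using this
  refine ⟨S.sup i, fun m hm => le_antisymm (f.monotone hm) ?_⟩
  refine (le_iSup f m).trans ?_
  rw [← hS, Subgroup.closure_le]
  exact fun s hs => f.monotone (Finset.le_sup hs) (hi s hs)

/-! ### Translation between quotients and elements in subnormal series -/

lemma cyclic_factor {H K : Subgroup G} (hle : K ≤ H) (hn : (K.subgroupOf H).Normal)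
    (hc : IsCyclic (H ⧸ K.subgroupOf H)) :
    (Infinite (H ⧸ K.subgroupOf H) → InfCyclic H K) ∧
      (¬ Infinite (H ⧸ K.subgroupOf H) → FinCyclic H K) := by
  obtain ⟨q, hq⟩ := hc
  obtain ⟨a, rfl⟩ := QuotientGroup.mk_surjective q
  have hpow : ∀ c : ℤ, ((a : H ⧸ K.subgroupOf H) ^ c = 1 ↔ (a : G) ^ c ∈ K) := fun c => by
    rw [← QuotientGroup.mk_zpow, QuotientGroup.eq_one_iff, Subgroup.mem_subgroupOf]; simp
  have ha : CyclicMod H K a := by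
    refine ⟨hle, fun h hh k hk => ?_, a.2, fun h hh => ?_⟩
    · simpa [Subgroup.mem_subgroupOf] using
        hn.conj_mem ⟨k, hle hk⟩ (by simpa [Subgroup.mem_subgroupOf] using hk) ⟨h, hh⟩
    · obtain ⟨c, hc⟩ := hq (QuotientGroup.mk ⟨h, hh⟩)
      refine ⟨c, ((a : G) ^ c)⁻¹ * h, ?_, by group⟩
      simp only [← QuotientGroup.mk_zpow] at hc
      simpa [Subgroup.mem_subgroupOf] using QuotientGroup.eq.1 hc
  constructor
  · intro inf
    refine ⟨a, ha, fun c hc => ?_⟩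
    by_contra h0
    have hfin : IsOfFinOrder (a : H ⧸ K.subgroupOf H) :=
      isOfFinOrder_iff_zpow_eq_one.2 ⟨c, h0, (hpow c).2 hc⟩
    have : Finite (Subgroup.zpowers (a : H ⧸ K.subgroupOf H)) :=
      (finite_zpowers.2 hfin).to_subtype
    exact inf.not_finite (Finite.of_surjective
      (fun x : Subgroup.zpowers (a : H ⧸ K.subgroupOf H) => (x : H ⧸ K.subgroupOf H))
      fun x => ⟨⟨x, hq x⟩, rfl⟩)
  · intro hfin
    have := not_infinite_iff_finite.1 hfin
    obtain ⟨c, h0, hc⟩ := isOfFinOrder_iff_zpow_eq_one.1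
      (isOfFinOrder_of_finite (a : H ⧸ K.subgroupOf H))
    exact ⟨a, ha, c, h0, (hpow c).1 hc⟩

lemma polycyclic_of_series {m : ℕ} (H : Fin (m + 1) → Subgroup G) (bot : H (Fin.last m) = ⊥)
    (le : ∀ i : Fin m, H i.succ ≤ H i.castSucc)
    (cyclic : ∀ i : Fin m, ∃ _ : ((H i.succ).subgroupOf (H i.castSucc)).Normal,
      IsCyclic (H i.castSucc ⧸ (H i.succ).subgroupOf (H i.castSucc))) :
    Polycyclic (H 0)
      (Nat.card {i : Fin m // Infinite (H i.castSucc ⧸ (H i.succ).subgroupOf (H i.castSucc))}) := by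
  classical
  induction m with
  | zero => simpa [← bot] using Polycyclic.bot (G := G)
  | succ m ih =>
    have key := ih (fun i => H i.succ) bot (fun i => le i.succ) (fun i => cyclic i.succ)
    obtain ⟨hn, hc⟩ := cyclic 0
    obtain ⟨h1, h2⟩ := cyclic_factor (le 0) hn hc
    rw [Nat.card_eq_fintype_card, Fintype.card_subtype] at key ⊢
    rw [Fin.card_filter_univ_succ]
    split_ifs with h0
    · exact .inf (h1 h0) key
    · exact .fin (h2 h0) key

lemma HasHirschLength.polycyclic {n : ℕ} (h : HasHirschLength G n) :
    Polycyclic (⊤ : Subgroup G) n := by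
  obtain ⟨m, H, hH, rfl⟩ := h
  rw [← hH.top]
  exact polycyclic_of_series H hH.bot hH.le hH.cyclic

lemma HasHirschLength.unique {n m : ℕ} (h : HasHirschLength G n) (h' : HasHirschLength G m) :
    n = m :=
  h.polycyclic.unique h'.polycyclic

end Hirsch

/-! ### Normal words and cyclic central series -/

section Words

open scoped commutatorElement

variable {G : Type*} [Group G] {n : ℕ}

@[simp]
lemma normalWord_fin_zero (a : Fin 0 → G) (x : Fin 0 → ℤ) : normalWord a x = 1 := by
  simp [normalWord]

lemma normalWord_succ (a : Fin (n + 1) → G) (x : Fin (n + 1) → ℤ) :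
    normalWord a x = a 0 ^ x 0 * normalWord (fun i => a i.succ) (fun i => x i.succ) := by
  simp [normalWord, List.ofFn_succ]

lemma normalWord_castSucc (a : Fin (n + 1) → G) (x : Fin (n + 1) → ℤ) :
    normalWord a x = normalWord (fun i => a i.castSucc) (fun i => x i.castSucc) *
      a (Fin.last n) ^ x (Fin.last n) := by
  rw [normalWord, List.ofFn_succ_last, List.prod_append, List.prod_singleton, normalWord]

lemma map_normalWord {G' : Type*} [Group G'] (f : G →* G') (a : Fin n → G) (x : Fin n → ℤ) :
    f (normalWord a x) = normalWord (fun i => f (a i)) x := by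
  simp [normalWord, map_list_prod, List.map_ofFn, Function.comp_def]

@[simp]
lemma normalWord_zero (a : Fin n → G) : normalWord a (fun _ => 0) = 1 := by
  simp [normalWord]

lemma normalWord_mem {a : Fin n → G} {K : Subgroup G} (h : ∀ i, a i ∈ K) (x : Fin n → ℤ) :
    normalWord a x ∈ K := by
  refine K.list_prod_mem fun g hg => ?_
  obtain ⟨i, rfl⟩ := List.mem_ofFn.1 hg
  exact K.zpow_mem (h i) _

lemma map_tailWord {G' : Type*} [Group G'] (f : G →* G') (a : Fin n → G) (j : Fin n)
    (w : Fin n → ℤ) : f (tailWord a j w) = tailWord (fun i => f (a i)) j w :=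
  map_normalWord f a _

lemma tailWord_congr (a : Fin n → G) {j : Fin n} {w w' : Fin n → ℤ}
    (h : ∀ k, j < k → w k = w' k) : tailWord a j w = tailWord a j w' := by
  unfold tailWord
  congr 1
  funext k
  split_ifs with hk
  exacts [h k hk, rfl]

lemma tailWord_zero (a : Fin (n + 1) → G) (w : Fin (n + 1) → ℤ) :
    tailWord a 0 w = normalWord (fun i => a i.succ) (fun i => w i.succ) := by
  simp [tailWord, normalWord_succ]

lemma tailWord_succ (a : Fin (n + 1) → G) (j : Fin n) (w : Fin (n + 1) → ℤ) :
    tailWord a j.succ w = tailWord (fun i => a i.succ) j (fun i => w i.succ) := by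
  simp [tailWord, normalWord_succ]

lemma zpow_mul_tailWord (a : Fin n → G) (j : Fin n) (c : ℤ) (w : Fin n → ℤ) :
    a j ^ c * tailWord a j w =
      normalWord a (fun l => if l = j then c else if j < l then w l else 0) := by
  induction n with
  | zero => exact j.elim0
  | succ n ih =>
    cases j using Fin.cases with
    | zero => simp [tailWord_zero, normalWord_succ]
    | succ j => simp [tailWord_succ, ih (fun i => a i.succ), normalWord_succ,
      (Fin.succ_ne_zero j).symm]

lemma exists_normalWord {a : Fin n → G} {K : Fin (n + 1) → Subgroup G}
    (bot : K (Fin.last n) = ⊥)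
    (exi : ∀ i, ∀ g ∈ K i.castSucc, ∃ c : ℤ, ∃ h ∈ K i.succ, g = a i ^ c * h) :
    ∀ j, ∀ g ∈ K j, ∃ x : Fin n → ℤ, (∀ i, i.castSucc < j → x i = 0) ∧ g = normalWord a x := by
  induction n with
  | zero =>
    intro j g hg
    obtain rfl : j = Fin.last 0 := Subsingleton.elim (α := Fin 1) _ _
    rw [bot, Subgroup.mem_bot] at hg
    exact ⟨fun _ => 0, by simp, by simp [hg]⟩
  | succ n ih =>
    have ih' := ih (a := fun i => a i.succ) (K := fun i => K i.succ) bot (fun i => exi i.succ)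
    intro j g hg
    cases j using Fin.cases with
    | zero =>
      obtain ⟨c, h, hh, rfl⟩ := exi 0 g hg
      obtain ⟨x, -, rfl⟩ := ih' 0 h hh
      exact ⟨Fin.cons c x, by simp, by simp [normalWord_succ]⟩
    | succ j =>
      obtain ⟨x, hx, rfl⟩ := ih' j g hg
      refine ⟨Fin.cons 0 x, fun i hi => ?_, by simp [normalWord_succ]⟩
      cases i using Fin.cases with
      | zero => rfl
      | succ i => exact hx i (by simpa [Fin.lt_def] using hi)

/-- Everything after the first factor lies in `K 1`, so freeness of `a 0` modulo `K 1` determines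
the first exponent; it is then cancelled. -/
lemma normalWord_injective_of_free {a : Fin n → G} {K : Fin (n + 1) → Subgroup G}
    (mem : ∀ i, a i ∈ K i.castSucc) (le : ∀ i : Fin n, K i.succ ≤ K i.castSucc)
    (free : ∀ (i : Fin n) (c : ℤ), a i ^ c ∈ K i.succ → c = 0) :
    Function.Injective (normalWord a) ∧
      ∀ x j, normalWord a x ∈ K j → ∀ i, i.castSucc < j → x i = 0 := by
  induction n with
  | zero => exact ⟨fun x y _ => Subsingleton.elim _ _, fun x j _ i => i.elim0⟩
  | succ n ih =>
    obtain ⟨ih1, ih2⟩ := ih (a := fun i => a i.succ) (K := fun i => K i.succ) (fun i => mem i.succ)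
      (fun i => le i.succ) (fun i => free i.succ)
    have mono : Antitone K := Fin.antitone_iff_succ_le.2 le
    have tail : ∀ x, normalWord (fun i => a i.succ) x ∈ K 1 :=
      normalWord_mem fun i => mono (by simp [Fin.le_def]) (mem i.succ)
    constructor
    · intro x y h
      rw [normalWord_succ, normalWord_succ] at h
      have h0 : x 0 - y 0 = 0 := free 0 _ (by
        have : a 0 ^ (x 0 - y 0) = normalWord (fun i => a i.succ) (fun i => y i.succ) *
          (normalWord (fun i => a i.succ) (fun i => x i.succ))⁻¹ := by
          rw [sub_eq_neg_add, zpow_add, eq_mul_inv_iff_mul_eq, mul_assoc, h]; group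
        rw [this]
        exact (K 1).mul_mem (tail _) ((K 1).inv_mem (tail _)))
      have h0' : x 0 = y 0 := by omega
      rw [h0'] at h
      have hs := ih1 (mul_left_cancel h)
      funext i
      cases i using Fin.cases with
      | zero => exact h0'
      | succ i => exact congrFun hs i
    · intro x j hx i hi
      cases j using Fin.cases with
      | zero => simp at hi
      | succ j =>
        rw [normalWord_succ] at hx
        have h0 : x 0 = 0 := free 0 _ (by
          have := mono (show (1 : Fin (n + 2)) ≤ j.succ by simp [Fin.le_def]) hx
          exact (Subgroup.mul_mem_cancel_right _ (tail _)).1 this)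
        cases i using Fin.cases with
        | zero => exact h0
        | succ i =>
          simp only [h0, zpow_zero, one_mul] at hx
          exact ih2 _ j hx i (by simpa [Fin.lt_def] using hi)

/-- `G = H 0 ≥ H 1 ≥ ⋯ ≥ H n = 1` is a central series with cyclic factors, and the coset
of `g i` generates the `i`-th factor. -/
structure IsCyclicCentralSeries (H : Fin (n + 1) → Subgroup G) (g : Fin n → G) : Prop where
  top : H 0 = ⊤
  bot : H (Fin.last n) = ⊥
  le : ∀ i : Fin n, H i.succ ≤ H i.castSucc
  central : ∀ i : Fin n, ⁅H i.castSucc, (⊤ : Subgroup G)⁆ ≤ H i.succ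
  gen : ∀ i : Fin n, H i.castSucc = Subgroup.zpowers (g i) ⊔ H i.succ

lemma IsCentralBasis.series {H : Fin (n + 1) → Subgroup G} {g : Fin n → G}
    (h : IsCentralBasis H g) : IsCyclicCentralSeries H g :=
  ⟨h.top, h.bot, h.le, h.central, h.gen⟩

namespace IsCyclicCentralSeries

variable {H : Fin (n + 1) → Subgroup G} {g : Fin n → G}

lemma normal (h : IsCyclicCentralSeries H g) (j : Fin (n + 1)) : (H j).Normal := by
  cases j using Fin.lastCases with
  | last => rw [h.bot]; infer_instance
  | cast i =>
    rw [← Subgroup.commutator_top_right_le_iff]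
    exact (h.central i).trans (h.le i)

lemma mem (h : IsCyclicCentralSeries H g) (i : Fin n) : g i ∈ H i.castSucc := by
  rw [h.gen]
  exact Subgroup.mem_sup_left (Subgroup.mem_zpowers _)

lemma exists_zpow_mul (h : IsCyclicCentralSeries H g) (i : Fin n) {x : G}
    (hx : x ∈ H i.castSucc) : ∃ c : ℤ, ∃ y ∈ H i.succ, x = g i ^ c * y := by
  have := h.normal i.succ
  rw [h.gen, Subgroup.mem_sup_of_normal_right] at hx
  obtain ⟨y, ⟨c, rfl⟩, z, hz, rfl⟩ := hx
  exact ⟨c, z, hz, rfl⟩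

lemma exists_word (h : IsCyclicCentralSeries H g) {j : Fin (n + 1)} {x : G} (hx : x ∈ H j) :
    ∃ e : Fin n → ℤ, (∀ i, i.castSucc < j → e i = 0) ∧ x = normalWord g e :=
  exists_normalWord h.bot (fun i _ hg => h.exists_zpow_mul i hg) j x hx

lemma exists_tailWord (h : IsCyclicCentralSeries H g) {j : Fin n} {x : G} (hx : x ∈ H j.succ) :
    ∃ e : Fin n → ℤ, x = tailWord g j e := by
  obtain ⟨e, he, rfl⟩ := h.exists_word hx
  refine ⟨e, ?_⟩
  unfold tailWord
  congr 1
  funext k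
  split_ifs with hk
  · rfl
  · exact he k (by rw [Fin.castSucc_lt_succ_iff]; exact not_lt.1 hk)

lemma cyclicMod (h : IsCyclicCentralSeries H g) (i : Fin n) :
    CyclicMod (H i.castSucc) (H i.succ) (g i) :=
  ⟨h.le i, fun x _ k hk => (h.normal i.succ).conj_mem k hk x, h.mem i,
    fun _ hx => h.exists_zpow_mul i hx⟩

lemma isCyclic (h : IsCyclicCentralSeries H g) (i : Fin n) :
    ∃ _ : ((H i.succ).subgroupOf (H i.castSucc)).Normal,
      IsCyclic (H i.castSucc ⧸ (H i.succ).subgroupOf (H i.castSucc)) := by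
  have := h.normal i.succ
  refine ⟨inferInstance, ⟨QuotientGroup.mk ⟨g i, h.mem i⟩, fun q => ?_⟩⟩
  obtain ⟨⟨x, hx⟩, rfl⟩ := QuotientGroup.mk_surjective q
  obtain ⟨c, y, hy, rfl⟩ := h.exists_zpow_mul i hx
  refine ⟨c, ?_⟩
  simp only [← QuotientGroup.mk_zpow]
  rw [QuotientGroup.eq]
  simpa [Subgroup.mem_subgroupOf] using hy

lemma isPolycyclicSeries (h : IsCyclicCentralSeries H g) : IsPolycyclicSeries H :=
  ⟨h.top, h.bot, h.le, h.isCyclic⟩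

lemma free_iff_infinite (h : IsCyclicCentralSeries H g) (i : Fin n) :
    (∀ c : ℤ, g i ^ c ∈ H i.succ → c = 0) ↔
      Infinite (H i.castSucc ⧸ (H i.succ).subgroupOf (H i.castSucc)) := by
  obtain ⟨hn, hc⟩ := h.isCyclic i
  obtain ⟨h1, h2⟩ := cyclic_factor (h.le i) hn hc
  constructor
  · intro hf
    by_contra hfin
    obtain ⟨a, ha, c, hc, hac⟩ := h2 hfin
    exact hc (hf c (ha.pow_mem_of_fin hac (h.mem i)))
  · intro hinf c hc
    by_contra h0
    obtain ⟨a, ha, hfree⟩ := h1 hinf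
    exact h0 (hfree c ((h.cyclicMod i).pow_mem_of_fin hc ha.mem))

/-- All factors are infinite if the Hirsch length equals the length of the series. -/
lemma infinite_of_hasHirschLength (h : IsCyclicCentralSeries H g) (hG : HasHirschLength G n)
    (i : Fin n) : Infinite (H i.castSucc ⧸ (H i.succ).subgroupOf (H i.castSucc)) := by
  classical
  -- By invariance, `n` is also the number of infinite factors of this particular series, which has
  -- only `n` factors.
  have key := hG.unique ⟨n, H, h.isPolycyclicSeries, rfl⟩
  rw [Nat.card_eq_fintype_card, Fintype.card_subtype] at key
  have : Finset.univ.filter (fun i : Fin n =>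
      Infinite (H i.castSucc ⧸ (H i.succ).subgroupOf (H i.castSucc))) = Finset.univ :=
    Finset.eq_univ_of_card _ (by rw [← key, Fintype.card_fin])
  simpa using Finset.ext_iff.1 this i

lemma isCentralBasis (h : IsCyclicCentralSeries H g) (hG : HasHirschLength G n) :
    IsCentralBasis H g :=
  ⟨h.top, h.bot, h.le, h.central, h.gen, h.infinite_of_hasHirschLength hG⟩

end IsCyclicCentralSeries

namespace IsCentralBasis

variable {H : Fin (n + 1) → Subgroup G} {g : Fin n → G}

lemma hasHirschLength (h : IsCentralBasis H g) : HasHirschLength G n := by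
  refine ⟨n, H, h.series.isPolycyclicSeries, ?_⟩
  have := h.infinite
  simp [this]

lemma normalWord_injective (h : IsCentralBasis H g) : Function.Injective (normalWord g) :=
  (normalWord_injective_of_free h.series.mem h.le
    fun i => (h.series.free_iff_infinite i).2 (h.infinite i)).1

end IsCentralBasis

/-! ### Sequences satisfying the relations of a nilpotent presentation -/

/-- The relations of `G(t)` hold for the sequence `a`. -/
def SatisfiesRelations (a : Fin n → G) (t : Triple n → ℤ) : Prop :=
  ∀ (i j : Fin n) (h : i < j), a j * a i = a i * a j * tailWord a j (exps t h)

/-- The subgroup generated by the `a_l` with `l ≥ j`. -/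
def tailClosure (a : Fin n → G) (j : Fin (n + 1)) : Subgroup G :=
  Subgroup.closure {g | ∃ l : Fin n, j ≤ l.castSucc ∧ a l = g}

lemma mem_tailClosure (a : Fin n → G) {j : Fin (n + 1)} {l : Fin n} (h : j ≤ l.castSucc) :
    a l ∈ tailClosure a j :=
  Subgroup.subset_closure ⟨l, h, rfl⟩

lemma tailWord_mem_tailClosure (a : Fin n → G) (j : Fin n) (w : Fin n → ℤ) :
    tailWord a j w ∈ tailClosure a j.succ := by
  refine Subgroup.list_prod_mem _ fun g hg => ?_
  obtain ⟨l, rfl⟩ := List.mem_ofFn.1 hg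
  dsimp only
  split_ifs with h
  · exact Subgroup.zpow_mem _ (mem_tailClosure a (Fin.succ_le_castSucc_iff.2 h)) _
  · simp

lemma tailClosure_castSucc (a : Fin n → G) (j : Fin n) :
    tailClosure a j.castSucc = Subgroup.zpowers (a j) ⊔ tailClosure a j.succ := by
  refine le_antisymm ?_ (sup_le ?_ ?_)
  · rw [tailClosure, Subgroup.closure_le]
    rintro _ ⟨l, hl, rfl⟩
    obtain rfl | hl := (show j ≤ l by simpa using hl).eq_or_lt
    · exact Subgroup.mem_sup_left (Subgroup.mem_zpowers _)
    · exact Subgroup.mem_sup_right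
        (mem_tailClosure a (Fin.succ_le_castSucc_iff.2 hl))
  · rw [Subgroup.zpowers_le]
    exact mem_tailClosure a le_rfl
  · exact Subgroup.closure_mono fun g ⟨l, hl, e⟩ => ⟨l, (Fin.castSucc_lt_succ).le.trans hl, e⟩

/-- Modulo the tail after `j`, the element `a j` commutes with every generator: with earlier ones by
the relations, with later ones because they become trivial. -/
lemma SatisfiesRelations.commutator_le {a : Fin n → G} {t : Triple n → ℤ}
    (ha : SatisfiesRelations a t) (hgen : Subgroup.closure (Set.range a) = ⊤) (j : Fin n)
    (hn : (tailClosure a j.succ).Normal) :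
    ⁅tailClosure a j.castSucc, (⊤ : Subgroup G)⁆ ≤ tailClosure a j.succ := by
  let π := QuotientGroup.mk' (tailClosure a j.succ)
  have hπ : ∀ x ∈ tailClosure a j.succ, π x = 1 := fun x hx => (QuotientGroup.eq_one_iff x).2 hx
  have hcomm : ∀ i, Commute (π (a j)) (π (a i)) := by
    intro i
    rcases lt_trichotomy i j with h | rfl | h
    · have := congrArg π (ha i j h)
      simp only [map_mul, hπ _ (tailWord_mem_tailClosure a j _), mul_one] at this
      exact this
    · exact Commute.refl _
    · rw [show π (a i) = 1 from hπ _ (mem_tailClosure a (Fin.succ_le_castSucc_iff.2 h))]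
      exact Commute.one_right _
  have hcenter : π (a j) ∈ Subgroup.center _ := by
    rw [Subgroup.mem_center_iff]
    intro q
    obtain ⟨g, rfl⟩ := QuotientGroup.mk'_surjective _ q
    have hg : g ∈ Subgroup.closure (Set.range a) := hgen ▸ Subgroup.mem_top g
    have hle : Subgroup.closure (Set.range a) ≤
        (Subgroup.centralizer {π (a j)}).comap π := by
      rw [Subgroup.closure_le]
      rintro _ ⟨i, rfl⟩
      exact Subgroup.mem_centralizer_singleton_iff.2 (hcomm i).symm
    exact Subgroup.mem_centralizer_singleton_iff.1 (hle hg)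
  have hle : tailClosure a j.castSucc ≤ (Subgroup.center _).comap π := by
    rw [tailClosure_castSucc, sup_le_iff, Subgroup.zpowers_le]
    refine ⟨hcenter, fun x hx => ?_⟩
    rw [Subgroup.mem_comap, hπ x hx]
    exact Subgroup.one_mem _
  rw [Subgroup.commutator_le]
  intro x hx y _
  rw [← QuotientGroup.eq_one_iff]
  change π ⁅x, y⁆ = 1
  rw [map_commutatorElement, commutatorElement_eq_one_iff_mul_comm]
  exact (Subgroup.mem_center_iff.1 (hle hx) (π y)).symm

lemma SatisfiesRelations.series {a : Fin n → G} {t : Triple n → ℤ}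
    (ha : SatisfiesRelations a t) (hgen : Subgroup.closure (Set.range a) = ⊤) :
    IsCyclicCentralSeries (tailClosure a) a := by
  have hbot : tailClosure a (Fin.last n) = ⊥ := by
    rw [tailClosure, Subgroup.closure_eq_bot_iff]
    rintro _ ⟨l, hl, rfl⟩
    exact absurd hl (not_le.2 (Fin.castSucc_lt_last l))
  have hle : ∀ j : Fin n, tailClosure a j.succ ≤ tailClosure a j.castSucc := fun j => by
    rw [tailClosure_castSucc]; exact le_sup_right
  have hnormal : ∀ j, (tailClosure a j).Normal := by
    intro j
    -- Normality climbs from the bottom: a normal tail makes the next larger one central modulo it,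
    -- hence normal.
    induction j using Fin.reverseInduction with
    | last => rw [hbot]; infer_instance
    | cast j ih =>
      rw [← Subgroup.commutator_top_right_le_iff]
      exact (ha.commutator_le hgen j ih).trans (hle j)
  refine ⟨?_, hbot, hle, fun j => ha.commutator_le hgen j (hnormal _), tailClosure_castSucc a⟩
  rw [eq_top_iff, ← hgen, tailClosure]
  exact Subgroup.closure_mono fun g ⟨l, e⟩ => ⟨l, Fin.zero_le _, e⟩

lemma IsCyclicCentralSeries.exists_relations {H : Fin (n + 1) → Subgroup G} {g : Fin n → G}
    (h : IsCyclicCentralSeries H g) : ∃ t, SatisfiesRelations g t := by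
  have : ∀ i j : Fin n, ∃ e : Fin n → ℤ, g j * g i = g i * g j * tailWord g j e := by
    intro i j
    -- This element is the commutator `⁅(g j)⁻¹, (g i)⁻¹⁆`.
    have hx : (g i * g j)⁻¹ * (g j * g i) ∈ H j.succ := by
      have := h.central j (Subgroup.commutator_mem_commutator ((H j.castSucc).inv_mem (h.mem j))
        (Subgroup.mem_top (g i)⁻¹))
      simpa [commutatorElement_def, mul_assoc] using this
    obtain ⟨e, he⟩ := h.exists_tailWord hx
    exact ⟨e, by rw [← he]; group⟩
  choose e he using this
  refine ⟨fun q => e q.i q.j q.k, fun i j hij => ?_⟩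
  rw [he i j]
  congr 1
  exact tailWord_congr g fun k hk => by simp [exps, hk]

/-! ### The groups `G(t)` -/

lemma satisfiesRelations_gen (t : Triple n → ℤ) : SatisfiesRelations (gen t) t := by
  intro i j h
  have : PresentedGroup.mk (relators t) ((FreeGroup.of j * FreeGroup.of i) *
      (FreeGroup.of i * FreeGroup.of j * tailWord FreeGroup.of j (exps t h))⁻¹) = 1 :=
    PresentedGroup.one_of_mem ⟨i, j, h, rfl⟩
  rw [map_mul, map_inv, mul_inv_eq_one, map_mul, map_mul, map_mul, map_tailWord] at this
  exact this

lemma closure_range_gen (t : Triple n → ℤ) : Subgroup.closure (Set.range (gen t)) = ⊤ :=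
  PresentedGroup.closure_range_of _

lemma isCentralBasis_gen {t : Triple n → ℤ} (ht : t ∈ consistentSet n) :
    IsCentralBasis (tailClosure (gen t)) (gen t) :=
  ((satisfiesRelations_gen t).series (closure_range_gen t)).isCentralBasis ht

/-- Every element of `G(t)` is a normal word, consistent or not, and normal words go to normal words
with the same exponents. Hence uniqueness of exponents in `G` gives injectivity. -/
lemma IsCentralBasis.exists_mulEquiv {H : Fin (n + 1) → Subgroup G} {g : Fin n → G}
    (h : IsCentralBasis H g) :
    ∃ t ∈ consistentSet n, ∃ e : NilGroup t ≃* G, ∀ i, e (HallPoly.gen t i) = g i := by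
  obtain ⟨t, ht⟩ := h.series.exists_relations
  have hrel : ∀ r ∈ relators t, FreeGroup.lift g r = 1 := by
    rintro _ ⟨i, j, hij, rfl⟩
    rw [map_mul, map_inv, mul_inv_eq_one, map_mul, map_mul, map_mul, map_tailWord]
    simpa using ht i j hij
  let f : NilGroup t →* G := PresentedGroup.toGroup hrel
  have hf : ∀ i, f (HallPoly.gen t i) = g i := fun i => PresentedGroup.toGroup.of hrel
  have hser := (satisfiesRelations_gen t).series (closure_range_gen t)
  have hword : ∀ x, f (normalWord (HallPoly.gen t) x) = normalWord g x := fun x => by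
    rw [map_normalWord]; simp only [hf]
  have hinj : Function.Injective f := by
    intro p q hpq
    obtain ⟨x, -, rfl⟩ := hser.exists_word (j := 0) (hser.top ▸ Subgroup.mem_top p)
    obtain ⟨y, -, rfl⟩ := hser.exists_word (j := 0) (hser.top ▸ Subgroup.mem_top q)
    rw [hword, hword] at hpq
    rw [h.normalWord_injective hpq]
  have hsurj : Function.Surjective f := by
    intro p
    obtain ⟨x, -, rfl⟩ := h.series.exists_word (j := 0) (h.top ▸ Subgroup.mem_top p)
    exact ⟨_, hword x⟩
  refine ⟨t, ?_, MulEquiv.ofBijective f ⟨hinj, hsurj⟩, hf⟩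
  -- Consistency: a power of a generator lying in the later tail is mapped to a coincidence of two
  -- normal words in `G`, so its exponent vanishes.
  refine IsCentralBasis.hasHirschLength (H := tailClosure (HallPoly.gen t)) (g := HallPoly.gen t)
    ⟨hser.top, hser.bot, hser.le, hser.central, hser.gen, fun i => ?_⟩
  rw [← hser.free_iff_infinite]
  intro c hc
  obtain ⟨e, he⟩ := hser.exists_tailWord hc
  have := congrArg f he
  rw [map_zpow, hf, map_tailWord] at this
  simp only [hf] at this
  have h1 := zpow_mul_tailWord g i c 0
  have h2 := zpow_mul_tailWord g i 0 e
  have h3 : tailWord g i 0 = 1 := by simp [tailWord]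
  rw [h3, mul_one] at h1
  rw [zpow_zero, one_mul] at h2
  simpa using congrFun (h.normalWord_injective (h1.symm.trans (this.trans h2))) i

end Words

/-! ### Torsion-free nilpotent polycyclic groups have central bases -/

section TGroup

open scoped commutatorElement

variable {G : Type*} [Group G]

lemma pow_mul_mul_inv_of_central {x g c : G} (hc : c ∈ Subgroup.center G)
    (h : x * g * x⁻¹ = c * g) (m : ℕ) : x ^ m * g * (x ^ m)⁻¹ = c ^ m * g := by
  induction m with
  | zero => simp
  | succ m ih =>
    have : x * c ^ m * x⁻¹ = c ^ m := by
      rw [Subgroup.mem_center_iff.1 (Subgroup.pow_mem _ hc m)]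
      group
    calc x ^ (m + 1) * g * (x ^ (m + 1))⁻¹ = x * (x ^ m * g * (x ^ m)⁻¹) * x⁻¹ := by
          rw [pow_succ']; group
      _ = (x * c ^ m * x⁻¹) * (x * g * x⁻¹) := by rw [ih]; group
      _ = c ^ (m + 1) * g := by rw [this, h, pow_succ]; group

/-- The factors of the upper central series inherit torsion-freeness: as `⁅x, g⁆` is central modulo
the `i`-th term, `⁅x ^ m, g⁆` is congruent to `⁅x, g⁆ ^ m`, and the induction hypothesis applies to
`⁅x, g⁆`. -/
lemma mem_upperCentralSeries_of_pow_mem (tf : ∀ (g : G) (m : ℕ), 0 < m → g ^ m = 1 → g = 1)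
    {m : ℕ} (hm : 0 < m) (i : ℕ) {x : G} (hx : x ∈ Subgroup.upperCentralSeries G (i + 1))
    (hxm : x ^ m ∈ Subgroup.upperCentralSeries G i) : x ∈ Subgroup.upperCentralSeries G i := by
  induction i generalizing x with
  | zero => exact tf x m hm hxm
  | succ i ih =>
    rw [Subgroup.mem_upperCentralSeries_succ_iff] at hx hxm ⊢
    intro g
    refine ih (hx g) ?_
    let π := QuotientGroup.mk' (Subgroup.upperCentralSeries G i)
    have hπ : ∀ y, π y = 1 ↔ y ∈ Subgroup.upperCentralSeries G i := QuotientGroup.eq_one_iff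
    have hc : π (x * g * x⁻¹ * g⁻¹) ∈ Subgroup.center _ := by
      rw [Subgroup.mem_center_iff]
      intro q
      obtain ⟨y, rfl⟩ := QuotientGroup.mk'_surjective _ q
      have := (hπ _).2 (Subgroup.mem_upperCentralSeries_succ_iff.1 (hx g) y)
      simp only [map_mul π, map_inv π] at this ⊢
      exact (commutatorElement_eq_one_iff_mul_comm.1 this).symm
    have key := pow_mul_mul_inv_of_central (x := π x) (g := π g) hc (by simp) m
    have h1 := (hπ _).2 (hxm g)
    rw [commutatorElement_def, map_mul, map_mul, map_mul, map_inv, map_inv, map_pow] at h1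
    rw [← hπ, map_pow]
    rw [mul_inv_eq_one] at h1
    rw [h1] at key
    exact mul_eq_right.1 key.symm

lemma mem_center_of_pow_mem [Group.IsNilpotent G]
    (tf : ∀ (g : G) (m : ℕ), 0 < m → g ^ m = 1 → g = 1) {m : ℕ} (hm : 0 < m) {x : G}
    (hxm : x ^ m ∈ Subgroup.center G) : x ∈ Subgroup.center G := by
  rw [← Subgroup.upperCentralSeries_one] at hxm ⊢
  have key : ∀ j, x ∈ Subgroup.upperCentralSeries G (j + 1) →
      x ∈ Subgroup.upperCentralSeries G 1 := by
    intro j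
    induction j with
    | zero => exact id
    | succ j ih =>
      exact fun hx => ih (mem_upperCentralSeries_of_pow_mem tf hm _ hx
        (Subgroup.upperCentralSeries_mono G (by omega) hxm))
  obtain ⟨c, hc⟩ := Group.IsNilpotent.nilpotent G
  exact key c (Subgroup.upperCentralSeries_mono G (Nat.le_succ c) (hc ▸ Subgroup.mem_top x))

/-- Torsion-freeness allows division of both exponents by their gcd. A Bézout relation between the
resulting coprime exponents then gives a generator of `⟨g, c⟩`. -/
lemma exists_zpowers_of_pow_eq (tf : ∀ (g : G) (m : ℕ), 0 < m → g ^ m = 1 → g = 1) {g c : G}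
    (hgc : Commute g c) {m : ℕ} (hm : 0 < m) {p : ℤ} (h : g ^ m = c ^ p) :
    ∃ i j : ℤ, g ∈ Subgroup.zpowers (g ^ i * c ^ j) ∧ c ∈ Subgroup.zpowers (g ^ i * c ^ j) := by
  have hm0 : (m : ℤ) ≠ 0 := by omega
  set e := Int.gcd m p with he
  have he0 : 0 < e := Int.gcd_pos_of_ne_zero_left _ hm0
  obtain ⟨m', hm'⟩ : (e : ℤ) ∣ m := Int.gcd_dvd_left ..
  obtain ⟨p', hp'⟩ : (e : ℤ) ∣ p := Int.gcd_dvd_right ..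
  have hcomm : ∀ k l : ℤ, Commute (g ^ k) (c ^ l) := fun k l => hgc.zpow_zpow k l
  have h' : g ^ m' = c ^ p' := by
    have := tf (g ^ m' * c ^ (-p')) e he0 (by
      rw [(hcomm _ _).mul_pow, ← zpow_natCast, ← zpow_natCast, ← zpow_mul, ← zpow_mul,
        mul_comm m', ← hm', neg_mul, mul_comm p', ← hp', zpow_natCast, h]
      simp)
    rwa [zpow_neg, mul_inv_eq_one] at this
  obtain ⟨i, j, hij⟩ : ∃ i j : ℤ, m' * j + p' * i = 1 := by
    refine ⟨Int.gcdB m p, Int.gcdA m p, ?_⟩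
    have := Int.gcd_eq_gcd_ab m p
    have he0' : (e : ℤ) ≠ 0 := by omega
    refine mul_left_cancel₀ he0' ?_
    rw [mul_add, ← mul_assoc, ← mul_assoc, ← hm', ← hp', mul_one]
    exact this.symm
  have hd : ∀ k : ℤ, (g ^ i * c ^ j) ^ k = g ^ (i * k) * c ^ (j * k) := fun k => by
    rw [(hcomm _ _).mul_zpow, ← zpow_mul, ← zpow_mul]
  refine ⟨i, j, ⟨p', ?_⟩, ⟨m', ?_⟩⟩
  · change (g ^ i * c ^ j) ^ p' = g
    rw [hd, mul_comm j, zpow_mul c, ← h', ← zpow_mul, ← zpow_add,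
      show i * p' + m' * j = 1 by linarith, zpow_one]
  · change (g ^ i * c ^ j) ^ m' = c
    rw [hd, mul_comm i, zpow_mul g, h', ← zpow_mul, ← zpow_add,
      show p' * i + j * m' = 1 by linarith, zpow_one]

/-- A nontrivial torsion-free nilpotent group with the maximal condition has a nontrivial central
element that generates an isolated subgroup. -/
lemma exists_isolated_central [Group.IsNilpotent G] [Nontrivial G] [WellFoundedGT (Subgroup G)]
    (tf : ∀ (g : G) (m : ℕ), 0 < m → g ^ m = 1 → g = 1) :
    ∃ c ∈ Subgroup.center G, c ≠ 1 ∧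
      ∀ (g : G) (m : ℕ), 0 < m → g ^ m ∈ Subgroup.zpowers c → g ∈ Subgroup.zpowers c := by
  obtain ⟨⟨z, hz⟩, hz1⟩ :=
    Subgroup.ne_bot_iff_exists_ne_one.1 (Group.IsNilpotent.center_ne_bot (G := G))
  replace hz1 : z ≠ 1 := fun h => hz1 (Subtype.ext h)
  let S : Set (Subgroup G) := {K | ∃ c ∈ Subgroup.center G, c ≠ 1 ∧ Subgroup.zpowers c = K}
  -- A maximal nontrivial cyclic central subgroup is isolated: a root `g` of one of its elements is
  -- central, and a cyclic subgroup containing both `g` and `c` cannot be larger.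
  obtain ⟨_, ⟨c, hc, hc1, rfl⟩, hmax⟩ := WellFounded.has_min (wellFounded_gt (α := Subgroup G)) S
    ⟨_, z, hz, hz1, rfl⟩
  refine ⟨c, hc, hc1, fun g m hm ⟨p, hp⟩ => ?_⟩
  have hg : g ∈ Subgroup.center G :=
    mem_center_of_pow_mem tf hm (hp ▸ Subgroup.zpow_mem _ hc p)
  obtain ⟨i, j, hgd, hcd⟩ := exists_zpowers_of_pow_eq tf
    (g := g) (c := c) (Subgroup.mem_center_iff.1 hc g) hm hp.symm
  have hle : Subgroup.zpowers c ≤ Subgroup.zpowers (g ^ i * c ^ j) := Subgroup.zpowers_le.2 hcd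
  have hd := hmax (Subgroup.zpowers (g ^ i * c ^ j)) ⟨_, Subgroup.mul_mem _
    (Subgroup.zpow_mem _ hg i) (Subgroup.zpow_mem _ hc j), fun h => hc1 ?_, rfl⟩
  · rw [hle.eq_of_not_lt hd]
    exact hgd
  · rw [h] at hcd
    simpa using hcd

/-- A central series from `G` to `N` with infinite cyclic factors. -/
structure IsCentralChain (N : Subgroup G) {m : ℕ} (H : Fin (m + 1) → Subgroup G) (g : Fin m → G) :
    Prop where
  top : H 0 = ⊤
  last : H (Fin.last m) = N
  le : ∀ i : Fin m, H i.succ ≤ H i.castSucc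
  central : ∀ i : Fin m, ⁅H i.castSucc, (⊤ : Subgroup G)⁆ ≤ H i.succ
  gen : ∀ i : Fin m, H i.castSucc = Subgroup.zpowers (g i) ⊔ H i.succ
  free : ∀ (i : Fin m) (c : ℤ), g i ^ c ∈ H i.succ → c = 0

lemma IsCentralChain.snoc {N N' : Subgroup G} {m : ℕ} {H : Fin (m + 1) → Subgroup G}
    {g : Fin m → G} (h : IsCentralChain N' H g) {c : G} (hN : N' = Subgroup.zpowers c ⊔ N)
    (hcen : ⁅N', (⊤ : Subgroup G)⁆ ≤ N) (hc : ∀ k : ℤ, c ^ k ∈ N → k = 0) :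
    IsCentralChain N (Fin.snoc H N : Fin (m + 2) → Subgroup G) (Fin.snoc g c : Fin (m + 1) → G) := by
  have e : ∀ i : Fin m, i.castSucc.succ = i.succ.castSucc := fun i => rfl
  refine ⟨?_, by simp, fun i => ?_, fun i => ?_, fun i => ?_, fun i => ?_⟩
  · rw [← Fin.castSucc_zero, Fin.snoc_castSucc, h.top]
  all_goals
    cases i using Fin.lastCases with
    | last => ?_
    | cast i => ?_
  all_goals simp only [e, Fin.succ_last, Fin.snoc_castSucc, Fin.snoc_last, h.last]
  · exact hN ▸ le_sup_right
  · exact h.le i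
  · exact hcen
  · exact h.central i
  · exact hN
  · exact h.gen i
  · exact hc
  · exact h.free i

/-- Noetherian induction upwards from `N`: an isolated central cyclic subgroup of the torsion-free
group `G / N` pulls back to a larger isolated `N'`, whose chain is extended by one step. Isolation
keeps the next quotient torsion-free. -/
lemma exists_centralChain [Group.IsNilpotent G] [WellFoundedGT (Subgroup G)] (N : Subgroup G)
    (hn : N.Normal) (iso : ∀ (g : G) (m : ℕ), 0 < m → g ^ m ∈ N → g ∈ N) :
    ∃ (m : ℕ) (H : Fin (m + 1) → Subgroup G) (g : Fin m → G), IsCentralChain N H g := by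
  induction N using WellFoundedGT.induction with
  | ind N ih =>
  by_cases hN : N = ⊤
  · exact ⟨0, fun _ => ⊤, Fin.elim0, rfl, hN.symm, fun i => i.elim0, fun i => i.elim0,
      fun i => i.elim0, fun i => i.elim0⟩
  let π := QuotientGroup.mk' N
  have hπ : ∀ x, π x = 1 ↔ x ∈ N := QuotientGroup.eq_one_iff
  have hsurj : Function.Surjective π := QuotientGroup.mk'_surjective N
  have : Nontrivial (G ⧸ N) := QuotientGroup.nontrivial_iff.2 hN
  have : WellFoundedGT (Subgroup (G ⧸ N)) := by
    have hmono : StrictMono (Subgroup.comap π) := fun A B hAB =>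
      (Subgroup.comap_lt_comap_of_surjective hsurj).2 hAB
    exact hmono.wellFoundedGT
  obtain ⟨q, hq, hq1, hiso⟩ := exists_isolated_central (G := G ⧸ N) (by
    intro q m hm hqm
    obtain ⟨g, rfl⟩ := hsurj q
    rw [← map_pow, hπ] at hqm
    exact (hπ g).2 (iso g m hm hqm))
  obtain ⟨c, rfl⟩ := hsurj q
  have hcN : c ∉ N := fun h => hq1 ((hπ c).2 h)
  have hmem : ∀ x, x ∈ Subgroup.zpowers c ⊔ N ↔ π x ∈ Subgroup.zpowers (π c) := by
    intro x
    rw [Subgroup.mem_sup_of_normal_right]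
    constructor
    · rintro ⟨_, ⟨k, rfl⟩, y, hy, rfl⟩
      exact ⟨k, by rw [map_mul, (hπ y).2 hy]; simp⟩
    · rintro ⟨k, hk⟩
      refine ⟨c ^ k, ⟨k, rfl⟩, (c ^ k)⁻¹ * x, (hπ _).1 ?_, by group⟩
      rw [map_mul, map_inv, map_zpow, inv_mul_eq_one]
      exact hk
  have hcen : ⁅Subgroup.zpowers c ⊔ N, (⊤ : Subgroup G)⁆ ≤ N := by
    rw [Subgroup.commutator_le]
    intro x hx y _
    rw [← hπ, map_commutatorElement, commutatorElement_eq_one_iff_mul_comm]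
    obtain ⟨k, hk⟩ := (hmem x).1 hx
    exact (Subgroup.mem_center_iff.1 (hk ▸ Subgroup.zpow_mem _ hq k : π x ∈ Subgroup.center _)
      (π y)).symm
  have hlt : N < Subgroup.zpowers c ⊔ N := by
    refine lt_of_le_of_ne le_sup_right fun h => hcN ?_
    rw [h]
    exact Subgroup.mem_sup_left (Subgroup.mem_zpowers c)
  obtain ⟨m, H, g, h⟩ := ih _ hlt
    (Subgroup.commutator_top_right_le_iff.1 (hcen.trans le_sup_right)) (fun g m hm hg => by
      rw [hmem] at hg ⊢
      exact hiso _ m hm (by simpa using hg))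
  refine ⟨m + 1, _, _, h.snoc rfl hcen fun k hk => ?_⟩
  by_contra h0
  refine hcN (iso c k.natAbs (Int.natAbs_pos.2 h0) ?_)
  obtain h | h := Int.natAbs_eq k
  · rw [h, zpow_natCast] at hk; exact hk
  · rw [h, zpow_neg, zpow_natCast] at hk; exact N.inv_mem_iff.1 hk

lemma IsCentralChain.isCentralBasis {m : ℕ} {H : Fin (m + 1) → Subgroup G} {g : Fin m → G}
    (h : IsCentralChain ⊥ H g) : IsCentralBasis H g :=
  have hs : IsCyclicCentralSeries H g := ⟨h.top, h.last, h.le, h.central, h.gen⟩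
  ⟨h.top, h.last, h.le, h.central, h.gen, fun i => (hs.free_iff_infinite i).1 (h.free i)⟩

lemma IsTGroup.exists_centralBasis (hG : IsTGroup G) {n : ℕ} (hn : HasHirschLength G n) :
    ∃ (H : Fin (n + 1) → Subgroup G) (g : Fin n → G), IsCentralBasis H g := by
  have := hG.nilpotent
  have : WellFoundedGT (Subgroup G) :=
    wellFoundedGT_subgroup fun N => hn.polycyclic.fg N le_top
  obtain ⟨m, H, g, h⟩ := exists_centralChain (G := G) ⊥ inferInstance (by
    intro g m hm hg
    by_contra h1
    exact hG.torsionFree g h1 (isOfFinOrder_iff_pow_eq_one.2 ⟨m, hm, hg⟩))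
  -- The construction does not control the length `m`; invariance of the Hirsch length identifies it
  -- with `n`.
  obtain rfl := hn.unique h.isCentralBasis.hasHirschLength
  exact ⟨H, g, h.isCentralBasis⟩

end TGroup

/-! ### The polynomial solution of a first order recursion -/

section SolveRec

variable {S : Type*} [CommRing S] [Algebra ℚ S]

lemma bernoulli_eval_sub (s : ℕ) (z : ℚ) :
    (Polynomial.bernoulli (s + 1)).eval z - bernoulli (s + 1) =
      ∑ k ∈ Finset.range (s + 1), bernoulli k * ((s + 1).choose k : ℚ) * z ^ (s + 1 - k) := by
  rw [Polynomial.bernoulli, Polynomial.eval_finsetSum, Finset.sum_range_succ]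
  simp

/-- Collecting the double sum by `s = m + k - 1`, the degree of the monomial of `g`, turns it into
Bernoulli polynomials, whose difference equation is known. -/
lemma eval₂_solveRec (φ : S →+* ℚ) (f₀ : S) (g : S[X]) (z : ℚ) :
    (solveRec f₀ g).eval₂ φ z = φ f₀ + ∑ s ∈ Finset.range (g.natDegree + 1),
      φ (g.coeff s) / (s + 1) * ((Polynomial.bernoulli (s + 1)).eval z - bernoulli (s + 1)) := by
  simp only [solveRec, Polynomial.eval₂_add, Polynomial.eval₂_C, Polynomial.eval₂_finsetSum,
    Polynomial.eval₂_monomial, map_sum, bernoulli_eval_sub, Finset.mul_sum]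
  congr 1
  rw [Finset.sum_sigma', Finset.sum_sigma']
  refine Finset.sum_bij' (fun p _ => ⟨p.1 + p.2 - 1, p.2⟩) (fun p _ => ⟨p.1 + 1 - p.2, p.2⟩)
    ?_ ?_ ?_ ?_ ?_
  · rintro ⟨m, k⟩ h
    simp only [Finset.mem_sigma, Finset.mem_Icc, Finset.mem_range] at h ⊢
    omega
  · rintro ⟨m, k⟩ h
    simp only [Finset.mem_sigma, Finset.mem_Icc, Finset.mem_range] at h ⊢
    omega
  · rintro ⟨m, k⟩ h
    simp only [Finset.mem_sigma, Finset.mem_Icc, Finset.mem_range] at h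
    simp only [Sigma.mk.injEq, heq_eq_eq, and_true]
    omega
  · rintro ⟨m, k⟩ h
    simp only [Finset.mem_sigma, Finset.mem_range] at h
    simp only [Sigma.mk.injEq, heq_eq_eq, and_true]
    omega
  · rintro ⟨m, k⟩ h
    simp only [Finset.mem_sigma, Finset.mem_Icc, Finset.mem_range] at h
    obtain ⟨m, rfl⟩ : ∃ m', m = m' + 1 := ⟨m - 1, by omega⟩
    have e2 : m + 1 + k = m + k + 1 := by omega
    have e3 : m + k + 1 - k = m + 1 := by omega
    simp only [e2, Nat.add_sub_cancel, e3, map_rat_smul, smul_eq_mul]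
    push_cast
    ring

lemma eval₂_solveRec_zero (φ : S →+* ℚ) (f₀ : S) (g : S[X]) :
    (solveRec f₀ g).eval₂ φ 0 = φ f₀ := by
  rw [eval₂_solveRec]
  simp [Polynomial.bernoulli_eval_zero]

lemma eval₂_solveRec_add_one (φ : S →+* ℚ) (f₀ : S) (g : S[X]) (z : ℚ) :
    (solveRec f₀ g).eval₂ φ (z + 1) = (solveRec f₀ g).eval₂ φ z + g.eval₂ φ z := by
  rw [eval₂_solveRec, eval₂_solveRec, add_assoc, Polynomial.eval₂_eq_sum_range,
    ← Finset.sum_add_distrib]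
  congr 1
  refine Finset.sum_congr rfl fun s _ => ?_
  rw [add_comm z 1, Polynomial.bernoulli_eval_one_add]
  have : (s : ℚ) + 1 ≠ 0 := by positivity
  push_cast
  field_simp
  ring

/-- An integer sequence with the recursion that `solveRec` solves agrees with the solution. -/
lemma eq_eval₂_solveRec (φ : S →+* ℚ) (g : S[X]) (w : ℤ → ℤ) (h0 : w 0 = 0)
    (h : ∀ z : ℤ, (w (z + 1) : ℚ) = w z + g.eval₂ φ (z : ℚ)) (z : ℤ) :
    (w z : ℚ) = (solveRec 0 g).eval₂ φ (z : ℚ) := by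
  induction z using Int.induction_on with
  | zero => rw [h0, Int.cast_zero, eval₂_solveRec_zero, map_zero]
  | succ i ih =>
    rw [h, ih, ← eval₂_solveRec_add_one]
    push_cast
    rfl
  | pred i ih =>
    have h1 := h (-i - 1)
    have h2 := eval₂_solveRec_add_one φ 0 g ((-i - 1 : ℤ) : ℚ)
    rw [sub_add_cancel, ih] at h1
    rw [show (((-i - 1 : ℤ) : ℚ) + 1) = ((-i : ℤ) : ℚ) by push_cast; ring] at h2
    linarith

end SolveRec

/-! ### Naturality of substitution -/

section Naturality

variable {A B : Type*} [CommRing A] [Algebra ℚ A] [CommRing B] [Algebra ℚ B] {n : ℕ}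
  (φ : A →+* B)

@[simp]
lemma param_X (τ : Triple n → A) (q : Triple n) : param τ (MvPolynomial.X q) = τ q := by
  simp [param]

lemma comp_param (τ : Triple n → A) : φ.comp (param τ) = param fun q => φ (τ q) := by
  refine MvPolynomial.ringHom_ext' (Subsingleton.elim _ _) fun q => ?_
  simp

/-- The inductive step substitutes polynomials into the polynomials for `n - 1`. Naturality lets a
later specialisation to numbers be carried out inside, so that only values of the old polynomials
over `ℚ` matter. -/
lemma map_subsF (f : MvPolynomial (Fin n ⊕ Fin n) (QT n)) (τ : Triple n → A) (x y : Fin n → A) :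
    φ (subsF f τ x y) = subsF f (fun q => φ (τ q)) (fun i => φ (x i)) (fun i => φ (y i)) := by
  rw [subsF, subsF, MvPolynomial.eval₂_comp_left, comp_param]
  congr 1
  funext s
  cases s <;> rfl

lemma map_subsK (f : (MvPolynomial (Fin n) (QT n))[X]) (τ : Triple n → A) (x : Fin n → A)
    (z : A) : φ (subsK f τ x z) = subsK f (fun q => φ (τ q)) (fun i => φ (x i)) (φ z) := by
  rw [subsK, subsK, Polynomial.hom_eval₂]
  congr 1
  refine MvPolynomial.ringHom_ext (fun r => ?_) fun i => ?_
  · simp [← comp_param]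
  · simp

lemma map_subsR (f : MvPolynomial (Fin 2) (QT n)) (τ : Triple n → A) (u v : A) :
    φ (subsR f τ u v) = subsR f (fun q => φ (τ q)) (φ u) (φ v) := by
  rw [subsR, subsR, MvPolynomial.eval₂_comp_left, comp_param]
  congr 1
  funext s
  fin_cases s <;> rfl

variable (D : Polys n)

lemma map_mul_polys (τ : Triple n → A) (x y : Fin n → A) :
    (fun i => φ (D.mul τ x y i)) =
      D.mul (fun q => φ (τ q)) (fun i => φ (x i)) (fun i => φ (y i)) :=
  funext fun _ => map_subsF φ _ τ x y

lemma map_pow_polys (τ : Triple n → A) (x : Fin n → A) (z : A) :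
    (fun i => φ (D.pow τ x z i)) = D.pow (fun q => φ (τ q)) (fun i => φ (x i)) (φ z) :=
  funext fun _ => map_subsK φ _ τ x z

lemma map_foldl_mul {ι : Type*} (l : List ι) (τ : Triple n → A) (x : Fin n → A)
    (f : ι → Fin n → A) :
    (fun i => φ (l.foldl (fun w j => D.mul τ w (f j)) x i)) =
      l.foldl (fun w j => D.mul (fun q => φ (τ q)) w (fun i => φ (f j i))) (fun i => φ (x i)) := by
  induction l generalizing x with
  | nil => rfl
  | cons j l ih => simp only [List.foldl_cons, ih, map_mul_polys]

end Naturality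

/-! ### Values of the polynomials of the inductive step -/

section StepValues

variable {A : Type*} [CommRing A] [Algebra ℚ A] {k : ℕ} (D : Polys (k + 2))
  (τ : Triple (k + 3) → A)

lemma eval₂Hom_param_C_X {σ : Type*} (x : σ → A) (q : Triple (k + 3)) :
    MvPolynomial.eval₂Hom (param τ) x (MvPolynomial.C (MvPolynomial.X q)) = τ q := by
  simp

lemma subsR_conj_C_X (τ' : Triple (k + 2) → Triple (k + 3)) (q : Triple (k + 2)) (u v : A) :
    subsR (D.conj (fun q' => MvPolynomial.C (MvPolynomial.X (τ' q')))
      q (MvPolynomial.X 0) (MvPolynomial.X 1)) τ u v = D.conj (fun q' => τ (τ' q')) q u v := by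
  change MvPolynomial.eval₂Hom (param τ) ![u, v] (subsR _ _ _ _) = _
  rw [map_subsR]
  simp [Polys.conj]

/-- This lemma, the next two and `subsR_stepR_new` evaluate the four branches of `stepR`. -/
lemma subsR_stepR_low {i j l : Fin (k + 2)} (h₁ : i < j) (h₂ : j < l) (u v : A) :
    subsR (stepR D ⟨i.castSucc, j.castSucc, l.castSucc, h₁, h₂⟩) τ u v =
      D.conj (paramW τ) ⟨i, j, l, h₁, h₂⟩ u v := by
  rw [stepR, dif_pos (Fin.castSucc_lt_last l)]
  exact subsR_conj_C_X D τ _ _ u v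

lemma subsR_stepR_succ {i j : Fin (k + 2)} (h₁ : i < j) (h₂ : j < Fin.last (k + 1)) (u v : A) :
    subsR (stepR D ⟨i.succ, j.succ, Fin.last _, Fin.succ_lt_succ_iff.2 h₁,
      Fin.succ_lt_succ_iff.2 h₂⟩) τ u v =
      D.conj (paramU τ) ⟨i, j, Fin.last _, h₁, h₂⟩ u v := by
  rw [stepR, dif_neg (lt_irrefl _), dif_pos (Fin.succ_pos i)]
  exact subsR_conj_C_X D τ _ _ u v

lemma subsR_stepR_zero {j : Fin (k + 1)} (h : j.succ < Fin.last (k + 1)) (u v : A) :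
    subsR (stepR D ⟨0, j.succ.succ, Fin.last _, Fin.succ_pos _, Fin.succ_lt_succ_iff.2 h⟩) τ u v =
      D.conj (paramV τ) ⟨0, j.succ, Fin.last _, Fin.succ_pos _, h⟩ u v := by
  rw [stepR, dif_neg (lt_irrefl _), dif_neg (lt_irrefl _),
    dif_pos (by simp [Fin.lt_def])]
  exact subsR_conj_C_X D τ _ _ u v

lemma map_lowR {B : Type*} [CommRing B] [Algebra ℚ B] (φ : A →+* B) (v : A) (j : Fin k) :
    φ (lowR D τ v j) = lowR D (fun q => φ (τ q)) (φ v) j := by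
  rw [lowR, Polys.conj, map_subsR, map_one]
  rfl

lemma map_stepProd {B : Type*} [CommRing B] [Algebra ℚ B] (φ : A →+* B) (v : A) :
    (fun l => φ (stepProd D τ v l)) = stepProd D (fun q => φ (τ q)) (φ v) := by
  have h : ∀ j : Fin (k + 2), (fun l => φ (conjGen τ j l)) = conjGen (fun q => φ (τ q)) j := by
    intro j
    funext l
    simp only [conjGen, exps]
    split_ifs <;> simp
  simp only [stepProd]
  rw [map_foldl_mul φ D _ (paramU τ)]
  simp only [map_pow_polys, h, map_lowR]
  rfl

/-- The value of `R_{1,2,n}(τ; 1, v)`. -/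
def rOne (v : A) : A := (newROne D).eval₂ (param τ) v

lemma subsR_stepR_new (h₁ : (0 : Fin (k + 3)) < 1) (h₂ : 1 < Fin.last (k + 2)) (u v : A) :
    subsR (stepR D ⟨0, 1, Fin.last _, h₁, h₂⟩) τ u v =
      D.pow (paramU τ) (Fin.cons 1 (Fin.snoc (lowR D τ v) (rOne D τ v) : Fin (k + 1) → A))
        u (Fin.last _) := by
  rw [stepR, dif_neg (lt_irrefl _), dif_neg (lt_irrefl _), dif_neg (lt_irrefl _), newR]
  change MvPolynomial.eval₂Hom (param τ) ![u, v] (subsK _ _ _ _) = _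
  rw [map_subsK, Polys.pow]
  congr 1
  · funext q
    exact eval₂Hom_param_C_X τ _ _
  · funext i
    cases i using Fin.cases with
    | zero => simp
    | succ i =>
      cases i using Fin.lastCases with
      | last =>
        simp only [Fin.cons_succ, Fin.snoc_last, rOne]
        rw [Polynomial.hom_eval₂]
        congr 1
        · exact MvPolynomial.eval₂Hom_comp_C _ _
        · simp
      | cast i =>
        simp only [Fin.cons_succ, Fin.snoc_castSucc]
        rw [map_lowR]
        congr 1
        · funext q
          exact eval₂Hom_param_C_X τ _ _
        · simp
  · simp

lemma eval₂_stepProd (v : A) :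
    (stepProd D (fun q => (Polynomial.C (MvPolynomial.X q) : (QT (k + 3))[X])) Polynomial.X
      (Fin.last _)).eval₂ (param τ) v = stepProd D τ v (Fin.last _) := by
  have := congrFun (map_stepProd D (fun q => (Polynomial.C (MvPolynomial.X q) : (QT (k + 3))[X]))
    (Polynomial.eval₂RingHom (param τ) v) Polynomial.X) (Fin.last _)
  simpa using this

/-- The value of `conjFactor`. -/
def conjFactorVal (x : Fin (k + 3) → A) (y : A) (i : Fin (k + 2)) : Fin (k + 2) → A := fun l =>
  if l = i then x i.succ
  else exps (fun q => subsR (stepR D q) τ (x i.succ) y) (Fin.succ_pos i) l.succ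

lemma subsF_newF (x y : Fin (k + 3) → A) :
    subsF (newF D) τ x y = D.mul (paramU τ)
      ((List.finRange (k + 1)).foldl
        (fun w i => D.mul (paramU τ) w (conjFactorVal D τ x (y 0) i.succ))
        (conjFactorVal D τ x (y 0) 0)) (fun l => y l.succ) (Fin.last _) := by
  let ψ := MvPolynomial.eval₂Hom (param τ) (Sum.elim x y)
  have hτ : ∀ q, ψ (MvPolynomial.C (MvPolynomial.X q)) = τ q := eval₂Hom_param_C_X τ _
  have hf : ∀ i, (fun l => ψ (conjFactor D i l)) = conjFactorVal D τ x (y 0) i := by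
    intro i
    funext l
    simp only [conjFactor, conjFactorVal, exps]
    split_ifs
    · simp [ψ]
    · rw [map_subsR]
      simp only [hτ]
      simp [ψ]
    · simp
  change ψ (subsF _ _ _ _) = _
  rw [map_subsF, Polys.mul]
  have h := map_foldl_mul ψ D (List.finRange (k + 1))
    (paramU (fun q => MvPolynomial.C (MvPolynomial.X q))) (conjFactor D 0)
    (fun i => conjFactor D i.succ)
  simp only [hf] at h
  rw [h]
  congr 1
  · funext q
    exact hτ _
  · simp only [paramU, hτ]
    rfl
  · simp [ψ]

lemma subsF_stepF_castSucc (x y : Fin (k + 3) → A) (i : Fin (k + 2)) :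
    subsF (stepF D i.castSucc) τ x y =
      D.mul (paramW τ) (fun i => x i.castSucc) (fun i => y i.castSucc) i := by
  rw [stepF, Fin.snoc_castSucc]
  change MvPolynomial.eval₂Hom (param τ) (Sum.elim x y) (subsF _ _ _ _) = _
  rw [map_subsF]
  simp only [Polys.mul, paramW, eval₂Hom_param_C_X]
  simp
  rfl

lemma eval₂RingHom_param_C_C_X (x : Fin (k + 3) → A) (z : A) (q : Triple (k + 3)) :
    Polynomial.eval₂RingHom (MvPolynomial.eval₂Hom (param τ) x) z
      (Polynomial.C (MvPolynomial.C (MvPolynomial.X q))) = τ q := by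
  simp

lemma subsK_lowK (x : Fin (k + 3) → A) (z : A) (i : Fin (k + 2)) :
    subsK (lowK D i) τ x z = D.pow (paramW τ) (fun i => x i.castSucc) z i := by
  refine (map_subsK (A := (MvPolynomial (Fin (k + 3)) (QT (k + 3)))[X])
    (Polynomial.eval₂RingHom (MvPolynomial.eval₂Hom (param τ) x) z) _ _ _ _).trans ?_
  simp only [Polys.pow, paramW, eval₂RingHom_param_C_C_X]
  simp
  rfl

/-- The increment `h(z)` of the powering recursion. The last slot is `0` because the central factor
there is accounted for by the recursion itself. -/
lemma subsK_step (x : Fin (k + 3) → A) (z : A) :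
    Polynomial.eval₂ (MvPolynomial.eval₂Hom (param τ) x) z
      (subsF (newF D) (fun q => Polynomial.C (MvPolynomial.C (MvPolynomial.X q)))
        (Fin.snoc (lowK D) 0 : Fin (k + 3) → _) (fun i => Polynomial.C (MvPolynomial.X i))) =
      subsF (newF D) τ
        (Fin.snoc (D.pow (paramW τ) (fun i => x i.castSucc) z) 0 : Fin (k + 3) → A) x := by
  refine (map_subsF (A := (MvPolynomial (Fin (k + 3)) (QT (k + 3)))[X])
    (Polynomial.eval₂RingHom (MvPolynomial.eval₂Hom (param τ) x) z) _ _ _ _).trans ?_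
  congr 1
  · funext q
    exact eval₂RingHom_param_C_C_X τ x z q
  · funext i
    cases i using Fin.lastCases with
    | last => simp
    | cast i =>
      simp only [Fin.snoc_castSucc]
      exact subsK_lowK D τ x z i
  · funext i
    simp

end StepValues

/-! ### Mal'cev bases -/

section Malcev

open scoped commutatorElement

universe u

variable {G : Type u} [Group G] {n : ℕ}

/-- The sequence `a` satisfies the relations of `G(t)` and normal words in `a` are unique. -/
structure IsMalcevBasis (a : Fin n → G) (t : Triple n → ℤ) : Prop where
  rel : SatisfiesRelations a t
  inj : Function.Injective (normalWord a)

/-- The polynomials `D` describe multiplication, powers and conjugation of normal words in `a`. -/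
structure Realizes (D : Polys n) (a : Fin n → G) (t : Triple n → ℤ) : Prop where
  mul : ∀ x y : Fin n → ℤ, ∃ w : Fin n → ℤ,
    D.mul (ratParam t) (ratVec x) (ratVec y) = ratVec w ∧
      normalWord a x * normalWord a y = normalWord a w
  pow : ∀ (x : Fin n → ℤ) (z : ℤ), ∃ w : Fin n → ℤ,
    D.pow (ratParam t) (ratVec x) (z : ℚ) = ratVec w ∧ normalWord a x ^ z = normalWord a w
  conj : ∀ (i j : Fin n) (hij : i < j) (u v : ℤ), ∃ w : Fin n → ℤ,
    (∀ (k : Fin n) (hjk : j < k),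
      (w k : ℚ) = D.conj (ratParam t) ⟨i, j, k, hij, hjk⟩ (u : ℚ) (v : ℚ)) ∧
    a j ^ u * a i ^ v = a i ^ v * a j ^ u * tailWord a j w

namespace IsMalcevBasis

variable {a : Fin n → G} {t : Triple n → ℤ}

lemma eq_of_tailWord_eq (ha : IsMalcevBasis a t) {j : Fin n} {w w' : Fin n → ℤ}
    (h : tailWord a j w = tailWord a j w') {k : Fin n} (hk : j < k) : w k = w' k := by
  simpa [hk] using congrFun (ha.inj h) k

/-- A basis need not generate the ambient group; this moves it into the subgroup that it generates.
-/
lemma of_comp {G' : Type u} [Group G'] (f : G' →* G) (hf : Function.Injective f) {a : Fin n → G'}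
    (ha : IsMalcevBasis (fun i => f (a i)) t) : IsMalcevBasis a t := by
  refine ⟨fun i j h => hf ?_, fun x y h => ha.inj ?_⟩
  · simp only [map_mul, map_tailWord]
    exact ha.rel i j h
  · rw [← map_normalWord, ← map_normalWord, h]

lemma exists_word (ha : IsMalcevBasis a t) (hgen : Subgroup.closure (Set.range a) = ⊤) (g : G) :
    ∃ x, g = normalWord a x := by
  have hs := ha.rel.series hgen
  obtain ⟨x, -, h⟩ := hs.exists_word (hs.top ▸ Subgroup.mem_top g)
  exact ⟨x, h⟩

lemma exists_tailWord (ha : IsMalcevBasis a t) (hgen : Subgroup.closure (Set.range a) = ⊤)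
    (i j : Fin n) (u v : ℤ) :
    ∃ w : Fin n → ℤ, a j ^ u * a i ^ v = a i ^ v * a j ^ u * tailWord a j w := by
  have hs := ha.rel.series hgen
  have := hs.central j (Subgroup.commutator_mem_commutator
    (Subgroup.inv_mem _ (Subgroup.zpow_mem _ (hs.mem j) u)) (Subgroup.mem_top (a i ^ v)⁻¹))
  obtain ⟨w, hw⟩ := hs.exists_tailWord this
  refine ⟨w, ?_⟩
  rw [← hw, commutatorElement_def]
  group

end IsMalcevBasis

lemma Realizes.map {G' : Type u} [Group G'] {D : Polys n} {a : Fin n → G'} {t : Triple n → ℤ}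
    (h : Realizes D a t) (f : G' →* G) : Realizes D (fun i => f (a i)) t := by
  refine ⟨fun x y => ?_, fun x z => ?_, fun i j hij u v => ?_⟩
  · obtain ⟨w, hw, e⟩ := h.mul x y
    refine ⟨w, hw, ?_⟩
    simp only [← map_normalWord, ← map_mul, e]
  · obtain ⟨w, hw, e⟩ := h.pow x z
    refine ⟨w, hw, ?_⟩
    simp only [← map_normalWord, ← map_zpow, e]
  · obtain ⟨w, hw, e⟩ := h.conj i j hij u v
    refine ⟨w, hw, ?_⟩
    simp only [← map_zpow, ← map_mul, ← map_tailWord, e]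

lemma Realizes.foldl {D : Polys n} {a : Fin n → G} {t : Triple n → ℤ} (h : Realizes D a t)
    {ι : Type*} (l : List ι) (x : Fin n → ℤ) (f : ι → Fin n → ℤ) :
    ∃ w : Fin n → ℤ,
      l.foldl (fun w j => D.mul (ratParam t) w (ratVec (f j))) (ratVec x) = ratVec w ∧
      normalWord a x * (l.map fun j => normalWord a (f j)).prod = normalWord a w := by
  induction l generalizing x with
  | nil => exact ⟨x, rfl, by simp⟩
  | cons j l ih =>
    obtain ⟨w, hw, e⟩ := h.mul x (f j)
    obtain ⟨w', hw', e'⟩ := ih w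
    exact ⟨w', by rw [List.foldl_cons, hw, hw'], by rw [List.map_cons, List.prod_cons, ← mul_assoc,
      e, e']⟩

lemma normalWord_eq_finRange_prod (a : Fin n → G) (x : Fin n → ℤ) :
    normalWord a x = ((List.finRange n).map fun i => a i ^ x i).prod := by
  rw [normalWord, List.ofFn_eq_map]

/-! ### The three shorter bases `U`, `V`, `W` -/

section Pieces

variable {k : ℕ} {a : Fin (k + 3) → G} {t : Triple (k + 3) → ℤ}

lemma Triple.skip_zero_mk {m : ℕ} {i j l : Fin m} (h₁ : i < j) (h₂ : j < l) :
    Triple.skip 0 ⟨i, j, l, h₁, h₂⟩ =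
      ⟨i.succ, j.succ, l.succ, Fin.succ_lt_succ_iff.2 h₁, Fin.succ_lt_succ_iff.2 h₂⟩ := by
  simp [Triple.skip]

lemma Triple.skip_last_mk {m : ℕ} {i j l : Fin m} (h₁ : i < j) (h₂ : j < l) :
    Triple.skip (Fin.last m) ⟨i, j, l, h₁, h₂⟩ = ⟨i.castSucc, j.castSucc, l.castSucc, h₁, h₂⟩ := by
  simp [Triple.skip]

/-- The basis of `U = ⟨a_2, …, a_n⟩`. -/
lemma IsMalcevBasis.basisU (ha : IsMalcevBasis a t) :
    IsMalcevBasis (fun i => a i.succ) (paramU t) := by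
  refine ⟨fun i j h => ?_, fun x y h => ?_⟩
  · rw [ha.rel i.succ j.succ (Fin.succ_lt_succ_iff.2 h), tailWord_succ]
    congr 2
    funext l
    simp only [exps, paramU, Fin.succ_lt_succ_iff]
    split_ifs
    · rw [Triple.skip_zero_mk]
    · rfl
  · have : normalWord a (Fin.cons 0 x) = normalWord a (Fin.cons 0 y) := by
      simpa [normalWord_succ a] using h
    exact (Fin.cons_injective2 (ha.inj this)).2

lemma one_succAbove_succ (j : Fin (k + 1)) : (1 : Fin (k + 3)).succAbove j.succ = j.succ.succ :=
  Fin.succAbove_of_le_castSucc _ _ (by simp [Fin.le_def])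

/-- The basis of `V = ⟨a_1, a_3, …, a_n⟩`. -/
lemma IsMalcevBasis.basisV (ha : IsMalcevBasis a t) :
    IsMalcevBasis (fun i => a ((1 : Fin (k + 3)).succAbove i)) (paramV t) := by
  refine ⟨fun i j h => ?_, fun x y h => ?_⟩
  -- The larger index `j` is not the first, so its relation has a tail beyond `a_3` only and the
  -- omitted `a_2` does not occur.
  · obtain ⟨j, rfl⟩ := Fin.exists_succ_eq_of_ne_zero ((Fin.zero_le i).trans_lt h).ne'
    rw [ha.rel _ _ (Fin.strictMono_succAbove 1 h)]
    congr 1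
    rw [tailWord_succ]
    simp only [one_succAbove_succ]
    rw [tailWord_succ, tailWord_succ]
    congr 1
    funext l
    simp only [exps, paramV, Fin.succ_lt_succ_iff, Triple.skip, one_succAbove_succ]
  · have key : ∀ x : Fin (k + 2) → ℤ,
        normalWord (fun i => a ((1 : Fin (k + 3)).succAbove i)) x =
          normalWord a (Fin.cons (x 0) (Fin.cons 0 fun i => x i.succ)) := by
      intro x
      simp [normalWord_succ]
    rw [key, key] at h
    have h := Fin.cons_injective2 (ha.inj h)
    have h' := (Fin.cons_injective2 h.2).2
    funext i
    cases i using Fin.cases with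
    | zero => exact h.1
    | succ i => exact congrFun h' i

lemma IsMalcevBasis.commute_last (ha : IsMalcevBasis a t)
    (hgen : Subgroup.closure (Set.range a) = ⊤) (g : G) : Commute (a (Fin.last _)) g := by
  have hs := ha.rel.series hgen
  have := hs.central (Fin.last _) (Subgroup.commutator_mem_commutator (hs.mem _)
    (Subgroup.mem_top g))
  rw [Fin.succ_last, hs.bot, Subgroup.mem_bot, commutatorElement_eq_one_iff_mul_comm] at this
  exact this

lemma tailWord_castSucc {m : ℕ} (a : Fin (m + 1) → G) (j : Fin m) (w : Fin (m + 1) → ℤ) :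
    tailWord a j.castSucc w = tailWord (fun i => a i.castSucc) j (fun i => w i.castSucc) *
      a (Fin.last m) ^ w (Fin.last m) := by
  simp [tailWord, normalWord_castSucc, Fin.castSucc_lt_last]

/-- The basis of `W = G / ⟨a_n⟩`. -/
lemma IsMalcevBasis.exists_basisW (ha : IsMalcevBasis a t)
    (hgen : Subgroup.closure (Set.range a) = ⊤) :
    ∃ (Q : Type u) (_ : Group Q) (π : G →* Q), π (a (Fin.last _)) = 1 ∧
      IsMalcevBasis (fun i => π (a i.castSucc)) (paramW t) := by
  have hcom := ha.commute_last hgen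
  have hn : (Subgroup.zpowers (a (Fin.last _))).Normal := by
    refine ⟨fun x hx g => ?_⟩
    obtain ⟨c, rfl⟩ := hx
    rw [← ((hcom g).zpow_left c).eq, mul_inv_cancel_right]
    exact ⟨c, rfl⟩
  let π := QuotientGroup.mk' (Subgroup.zpowers (a (Fin.last _)))
  have hlast : π (a (Fin.last _)) = 1 := (QuotientGroup.eq_one_iff _).2 (Subgroup.mem_zpowers _)
  refine ⟨_, inferInstance, π, hlast, fun i j h => ?_, fun x y h => ?_⟩
  · have := congrArg π (ha.rel i.castSucc j.castSucc h)
    rw [map_mul, map_mul, map_mul, tailWord_castSucc, map_mul, map_zpow, hlast, one_zpow,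
      mul_one, map_tailWord] at this
    rw [this]
    congr 2
    funext l
    simp only [exps, paramW, Fin.castSucc_lt_castSucc_iff]
    split_ifs
    · rw [Triple.skip_last_mk]
    · rfl
  · rw [← map_normalWord π (fun i => a i.castSucc), ← map_normalWord π (fun i => a i.castSucc)] at h
    -- Words with equal images differ by a power of `a_n`, which is absorbed in the last exponent.
    obtain ⟨c, hc⟩ := QuotientGroup.eq.1 h
    have : normalWord a (Fin.snoc y 0) = normalWord a (Fin.snoc x c) := by
      simp only [normalWord_castSucc a, Fin.snoc_castSucc, Fin.snoc_last, zpow_zero, mul_one]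
      have hc' : a (Fin.last _) ^ c = _ := hc
      rw [hc', mul_inv_cancel_left]
    exact (Fin.snoc_injective2 (ha.inj this)).1.symm

end Pieces

end Malcev

/-! ### The inductive step -/

section Step

universe u

variable {G : Type u} [Group G] {k : ℕ} {D : Polys (k + 2)} {a : Fin (k + 3) → G}
  {t : Triple (k + 3) → ℤ}

/-- The inherited exponents: the relation is mapped to `W`, or read in `U` or `V`, and compared with
the induction hypothesis there by uniqueness of normal words. The excluded case is `R_{1,2,n}`,
since `j = 1` leaves only `i = 0`. -/
lemma conj_realizes_step
    (hD : ∀ {Q : Type u} [Group Q] (b : Fin (k + 2) → Q) (s : Triple (k + 2) → ℤ),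
      IsMalcevBasis b s → Realizes D b s)
    (ha : IsMalcevBasis a t) (hgen : Subgroup.closure (Set.range a) = ⊤)
    {i j : Fin (k + 3)} (hij : i < j) {u v : ℤ} {w : Fin (k + 3) → ℤ}
    (hw : a j ^ u * a i ^ v = a i ^ v * a j ^ u * tailWord a j w)
    (l : Fin (k + 3)) (hjl : j < l) (hl : ¬ (j = 1 ∧ l = Fin.last _)) :
    (w l : ℚ) = subsR (stepR D ⟨i, j, l, hij, hjl⟩) (ratParam t) u v := by
  cases l using Fin.lastCases with
  | cast l =>
    obtain ⟨j, rfl⟩ := Fin.exists_castSucc_eq.2 (hjl.trans (Fin.castSucc_lt_last l)).ne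
    obtain ⟨i, rfl⟩ := Fin.exists_castSucc_eq.2 (hij.trans (Fin.castSucc_lt_last j)).ne
    obtain ⟨Q, _, π, hlast, hb⟩ := ha.exists_basisW hgen
    obtain ⟨w', hw', e⟩ := (hD _ _ hb).conj i j hij u v
    have h := congrArg π hw
    rw [tailWord_castSucc] at h
    simp only [map_mul, map_zpow, hlast, one_zpow, mul_one, map_tailWord] at h
    rw [e] at h
    have := hb.eq_of_tailWord_eq (mul_left_cancel h) (k := l) hjl
    rw [subsR_stepR_low D _ hij hjl, ← this, hw' l hjl]
    rfl
  | last =>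
    cases i using Fin.cases with
    | succ i =>
      obtain ⟨j, rfl⟩ := Fin.exists_succ_eq_of_ne_zero ((Fin.zero_le _).trans_lt hij).ne'
      have hij' := Fin.succ_lt_succ_iff.1 hij
      have hjl' : j < Fin.last (k + 1) := Fin.succ_lt_succ_iff.1 (by rwa [Fin.succ_last])
      obtain ⟨w', hw', e⟩ := (hD _ _ ha.basisU).conj i j hij' u v
      rw [tailWord_succ, e] at hw
      have := ha.basisU.eq_of_tailWord_eq (mul_left_cancel hw) hjl'
      rw [Fin.succ_last] at this
      rw [subsR_stepR_succ D _ hij' hjl', ← this, hw' _ hjl']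
      rfl
    | zero =>
      obtain ⟨j, rfl⟩ := Fin.exists_succ_eq_of_ne_zero hij.ne'
      obtain ⟨j, rfl⟩ := Fin.exists_succ_eq_of_ne_zero
        (show j ≠ 0 from fun h => hl ⟨by rw [h]; rfl, rfl⟩)
      have hjl' : j.succ < Fin.last (k + 1) := Fin.succ_lt_succ_iff.1 (by rwa [Fin.succ_last])
      obtain ⟨w', hw', e⟩ := (hD _ _ ha.basisV).conj 0 j.succ (Fin.succ_pos j) u v
      rw [tailWord_succ] at e
      simp only [one_succAbove_succ] at e
      rw [tailWord_succ, tailWord_succ] at hw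
      have h0 : (1 : Fin (k + 3)).succAbove 0 = 0 := by simp
      rw [h0, hw, mul_right_inj] at e
      have e' : tailWord (fun i => a ((1 : Fin (k + 3)).succAbove i)) j.succ
          (Fin.cons 0 fun l => w l.succ.succ) =
          tailWord (fun i => a ((1 : Fin (k + 3)).succAbove i)) j.succ w' := by
        rw [tailWord_succ, tailWord_succ]
        simpa only [one_succAbove_succ, Fin.cons_succ] using e
      have := ha.basisV.eq_of_tailWord_eq e' hjl'
      rw [← Fin.succ_last, Fin.cons_succ, Fin.succ_last, Fin.succ_last] at this
      rw [subsR_stepR_zero D _ hjl', this, hw' _ hjl']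
      rfl

lemma zpow_mul_tailWord_succ (a : Fin (k + 3) → G) (i : Fin (k + 2)) (c : ℤ)
    (w : Fin (k + 3) → ℤ) :
    a i.succ ^ c * tailWord a i.succ w = normalWord (fun i => a i.succ)
      (fun l => if l = i then c else if i < l then w l.succ else 0) := by
  rw [tailWord_succ]
  exact zpow_mul_tailWord (fun i => a i.succ) i c _

/-- The exponents of `a_j ^ {a_1}`, as integers. -/
def conjGenInt (t : Triple (k + 3) → ℤ) (j l : Fin (k + 2)) : ℤ :=
  if l = j then 1 else exps t (Fin.succ_pos j) l.succ

lemma ratVec_conjGenInt (t : Triple (k + 3) → ℤ) (j : Fin (k + 2)) :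
    ratVec (conjGenInt t j) = conjGen (ratParam t) j := by
  funext l
  simp only [ratVec, conjGenInt, conjGen, exps, ratParam]
  split_ifs <;> simp

lemma SatisfiesRelations.conj_gen (ha : SatisfiesRelations a t) (j : Fin (k + 2)) :
    (a 0)⁻¹ * a j.succ * a 0 = normalWord (fun i => a i.succ) (conjGenInt t j) := by
  rw [mul_assoc, ha 0 j.succ (Fin.succ_pos j), mul_assoc, inv_mul_cancel_left]
  have := zpow_mul_tailWord_succ a j 1 (exps t (Fin.succ_pos j))
  rw [zpow_one] at this
  rw [this]
  congr 1
  funext l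
  simp only [conjGenInt]
  split_ifs with h1 h2
  · rfl
  · rfl
  · rw [exps, dif_neg (by rwa [Fin.succ_lt_succ_iff])]

/-- The coordinates of `a_2 ^ {a_1 ^ v}` satisfy the recursion that defines `R_{1,2,n}(T; 1, v)`. -/
lemma coord_conj_succ
    (hD : ∀ {Q : Type u} [Group Q] (b : Fin (k + 2) → Q) (s : Triple (k + 2) → ℤ),
      IsMalcevBasis b s → Realizes D b s)
    (ha : IsMalcevBasis a t) (hgen : Subgroup.closure (Set.range a) = ⊤)
    {v : ℤ} {r r' : Fin (k + 2) → ℤ}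
    (hr : (a 0 ^ v)⁻¹ * a 1 * a 0 ^ v = normalWord (fun i => a i.succ) r)
    (hr' : (a 0 ^ (v + 1))⁻¹ * a 1 * a 0 ^ (v + 1) = normalWord (fun i => a i.succ) r')
    (h0 : r 0 = 1) (hlow : ∀ j : Fin k, (r j.succ.castSucc : ℚ) = lowR D (ratParam t) v j) :
    (r' (Fin.last _) : ℚ) =
      r (Fin.last _) + stepProd D (ratParam t) (v : ℚ) (Fin.last _) := by
  have hU := hD _ _ ha.basisU
  choose f hf hf' using fun j : Fin k => hU.pow (conjGenInt t j.succ.castSucc) (r j.succ.castSucc)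
  obtain ⟨w, hw, hw'⟩ := hU.foldl (List.finRange k) (conjGenInt t 0) f
  have hstep : stepProd D (ratParam t) (v : ℚ) = ratVec w := by
    rw [← hw, stepProd, ratVec_conjGenInt]
    congr 1
    funext w j
    rw [← hf, ratVec_conjGenInt, hlow]
    rfl
  let c : G →* G := (MulAut.conj (a 0)⁻¹).toMonoidHom
  have hc : ∀ x, c x = (a 0)⁻¹ * x * a 0 := fun x => by simp [c]
  -- Conjugation by `a_1` acts factor by factor on the word for `r`. The leading factor `a_2` and
  -- the middle factors give the product in `stepProd`, and the central last factor is unchanged.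
  have key : normalWord (fun i => a i.succ) r' =
      normalWord (fun i => a i.succ) w * a (Fin.last _) ^ r (Fin.last _) := by
    rw [← hr', ← hw']
    have : (a 0 ^ (v + 1))⁻¹ * a 1 * a 0 ^ (v + 1) = c ((a 0 ^ v)⁻¹ * a 1 * a 0 ^ v) := by
      rw [hc, zpow_add, zpow_one]; group
    rw [this, hr, map_normalWord, normalWord_succ, normalWord_castSucc, h0, zpow_one]
    simp only [hc]
    rw [ha.rel.conj_gen, Fin.succ_last, Fin.succ_last,
      ((ha.commute_last hgen (a 0)⁻¹).eq).symm, inv_mul_cancel_right,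
      normalWord_eq_finRange_prod (n := k),
      ← mul_assoc]
    congr 3
    refine List.map_congr_left fun j _ => ?_
    rw [ha.rel.conj_gen, ← hf']
    rfl
  have key' : normalWord (fun i => a i.succ) r' = normalWord (fun i => a i.succ)
      (Fin.snoc (fun i => w i.castSucc) (w (Fin.last _) + r (Fin.last _)) : Fin (k + 2) → ℤ) := by
    rw [key, normalWord_castSucc _ w, normalWord_castSucc _ (Fin.snoc _ _)]
    simp only [Fin.snoc_castSucc, Fin.snoc_last, Fin.succ_last, zpow_add, mul_assoc]
  have := congrFun (ha.basisU.inj key') (Fin.last _)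
  rw [Fin.snoc_last] at this
  rw [this, hstep, ratVec]
  push_cast
  ring

/-- For `u = 1` the last exponent, as a function of `v`, vanishes at `0` and satisfies the recursion
solved by `newROne`. General `u` follows because the conjugate of a power is the power of the
conjugate, which is computed in `U`. -/
lemma conj_realizes_new
    (hD : ∀ {Q : Type u} [Group Q] (b : Fin (k + 2) → Q) (s : Triple (k + 2) → ℤ),
      IsMalcevBasis b s → Realizes D b s)
    (ha : IsMalcevBasis a t) (hgen : Subgroup.closure (Set.range a) = ⊤)
    {u v : ℤ} {w : Fin (k + 3) → ℤ}
    (hw : a 1 ^ u * a 0 ^ v = a 0 ^ v * a 1 ^ u * tailWord a 1 w)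
    (h₁ : (0 : Fin (k + 3)) < 1) (h₂ : 1 < Fin.last (k + 2)) :
    (w (Fin.last _) : ℚ) = subsR (stepR D ⟨0, 1, Fin.last _, h₁, h₂⟩) (ratParam t) u v := by
  have hword : ∀ (u : ℤ) (w : Fin (k + 3) → ℤ), a 1 ^ u * tailWord a 1 w =
      normalWord (fun i => a i.succ) (Fin.cons u fun l => w l.succ.succ) := by
    intro u w
    refine (zpow_mul_tailWord_succ a 0 u w).trans ?_
    congr 1
    funext l
    cases l using Fin.cases <;> simp
  choose s hs using fun v : ℤ => ha.exists_tailWord hgen 0 1 1 v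
  let r : ℤ → Fin (k + 2) → ℤ := fun v => Fin.cons 1 fun l => s v l.succ.succ
  have hr : ∀ v, (a 0 ^ v)⁻¹ * a 1 * a 0 ^ v = normalWord (fun i => a i.succ) (r v) := by
    intro v
    have := hs v
    rw [zpow_one, mul_assoc] at this
    rw [mul_assoc, this, inv_mul_cancel_left, ← hword, zpow_one]
  have hlow : ∀ v (j : Fin k), (r v j.succ.castSucc : ℚ) = lowR D (ratParam t) v j := by
    intro v j
    have h := conj_realizes_step hD ha hgen h₁ (hs v) j.succ.succ.castSucc
      (by simp [Fin.lt_def]) (fun h => (Fin.castSucc_lt_last _).ne h.2)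
    have e := subsR_stepR_low D (ratParam t) (i := 0) (j := 1) (l := j.succ.succ)
      (by simp) (by simp [Fin.lt_def]) ((1 : ℤ) : ℚ) (v : ℚ)
    refine h.trans (e.trans ?_)
    rw [lowR, Int.cast_one]
  have hone : ∀ v : ℤ, (r v (Fin.last _) : ℚ) = rOne D (ratParam t) v := by
    refine eq_eval₂_solveRec (param (ratParam t)) _ (fun v => r v (Fin.last _)) ?_ fun v => ?_
    · have h0 : tailWord a 1 (s 0) = tailWord a 1 0 := by
        have := hs 0
        simp only [zpow_one, zpow_zero, mul_one, one_mul] at this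
        have h1 : tailWord a 1 0 = 1 := by simp [tailWord]
        rw [h1]
        exact mul_eq_left.1 this.symm
      exact ha.eq_of_tailWord_eq h0 h₂
    · rw [eval₂_stepProd]
      exact coord_conj_succ hD ha hgen (hr v) (hr (v + 1)) rfl (hlow v)
  have hvec : (Fin.cons 1 (Fin.snoc (lowR D (ratParam t) (v : ℚ))
      (rOne D (ratParam t) (v : ℚ)) : Fin (k + 1) → ℚ) : Fin (k + 2) → ℚ) = ratVec (r v) := by
    funext l
    cases l using Fin.cases with
    | zero => simp [ratVec, r]
    | succ l =>
      rw [Fin.cons_succ]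
      cases l using Fin.lastCases with
      | last => rw [Fin.snoc_last, ← hone]; rfl
      | cast l => rw [Fin.snoc_castSucc, ← hlow]; rfl
  obtain ⟨w', hw', e⟩ := (hD _ _ ha.basisU).pow (r v) u
  have h : normalWord (fun i => a i.succ) (Fin.cons u fun l => w l.succ.succ) =
      normalWord (fun i => a i.succ) w' := by
    rw [← e, ← hr, ← hword]
    have hz : ((a 0 ^ v)⁻¹ * a 1 * a 0 ^ v) ^ u = (a 0 ^ v)⁻¹ * a 1 ^ u * a 0 ^ v := by
      have := conj_zpow (a := (a 0 ^ v)⁻¹) (b := a 1) (i := u)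
      simpa using this
    rw [hz, mul_assoc, hw, mul_assoc, inv_mul_cancel_left]
  have hl := congrFun (ha.basisU.inj h) (Fin.last _)
  rw [← Fin.succ_last, Fin.cons_succ, Fin.succ_last, Fin.succ_last] at hl
  rw [subsR_stepR_new, hvec, hl]
  exact (congrFun hw' (Fin.last _)).symm

lemma exists_conj
    (hD : ∀ {Q : Type u} [Group Q] (b : Fin (k + 2) → Q) (s : Triple (k + 2) → ℤ),
      IsMalcevBasis b s → Realizes D b s)
    (ha : IsMalcevBasis a t) (hgen : Subgroup.closure (Set.range a) = ⊤)
    (i j : Fin (k + 3)) (hij : i < j) (u v : ℤ) : ∃ w : Fin (k + 3) → ℤ,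
    (∀ (l : Fin (k + 3)) (hjl : j < l),
      (w l : ℚ) = subsR (stepR D ⟨i, j, l, hij, hjl⟩) (ratParam t) (u : ℚ) (v : ℚ)) ∧
    a j ^ u * a i ^ v = a i ^ v * a j ^ u * tailWord a j w := by
  obtain ⟨w, hw⟩ := ha.exists_tailWord hgen i j u v
  refine ⟨w, fun l hjl => ?_, hw⟩
  by_cases h : j = 1 ∧ l = Fin.last _
  · obtain ⟨rfl, rfl⟩ := h
    obtain rfl : i = 0 := by
      rw [Fin.lt_def] at hij
      exact Fin.ext (by simpa using hij)
    exact conj_realizes_new hD ha hgen hw hij hjl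
  · exact conj_realizes_step hD ha hgen hij hw l hjl h

/-- With `X`, `Y` the parts of the two words in `U`, one has `a_1 ^ x_1 X · a_1 ^ y_1 Y = a_1 ^ (x_1
+ y_1) · X ^ {a_1 ^ y_1} Y`, where `X` is conjugated factor by factor. Only the last exponent is
matched with a polynomial here; the others are obtained from `W`. -/
lemma exists_mul
    (hD : ∀ {Q : Type u} [Group Q] (b : Fin (k + 2) → Q) (s : Triple (k + 2) → ℤ),
      IsMalcevBasis b s → Realizes D b s)
    (ha : IsMalcevBasis a t) (hgen : Subgroup.closure (Set.range a) = ⊤)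
    (x y : Fin (k + 3) → ℤ) : ∃ w : Fin (k + 3) → ℤ,
    (w (Fin.last _) : ℚ) = subsF (newF D) (ratParam t) (ratVec x) (ratVec y) ∧
      normalWord a x * normalWord a y = normalWord a w := by
  have hU := hD _ _ ha.basisU
  choose s hs hs' using fun i : Fin (k + 2) =>
    exists_conj hD ha hgen 0 i.succ (Fin.succ_pos i) (x i.succ) (y 0)
  let f : Fin (k + 2) → Fin (k + 2) → ℤ := fun i l =>
    if l = i then x i.succ else if i < l then s i l.succ else 0
  have hf : ∀ i, ratVec (f i) = conjFactorVal D (ratParam t) (ratVec x) (ratVec y 0) i := by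
    intro i
    funext l
    simp only [ratVec, f, conjFactorVal, exps, Fin.succ_lt_succ_iff]
    split_ifs with h1 h2
    · rfl
    · rw [hs i l.succ (Fin.succ_lt_succ_iff.2 h2)]
    · simp
  have hconj : ∀ i, (a 0 ^ y 0)⁻¹ * a i.succ ^ x i.succ * a 0 ^ y 0 =
      normalWord (fun i => a i.succ) (f i) := by
    intro i
    rw [mul_assoc, hs' i, mul_assoc, inv_mul_cancel_left]
    exact zpow_mul_tailWord_succ a i _ _
  obtain ⟨w₁, hw₁, e₁⟩ := hU.foldl (List.finRange (k + 1)) (f 0) (fun i => f i.succ)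
  obtain ⟨w₂, hw₂, e₂⟩ := hU.mul w₁ (fun i => y i.succ)
  refine ⟨Fin.cons (x 0 + y 0) w₂, ?_, ?_⟩
  · rw [← Fin.succ_last, Fin.cons_succ, subsF_newF]
    refine (congrFun hw₂ (Fin.last _)).symm.trans ?_
    rw [← hw₁]
    simp only [hf]
    rfl
  · let c : G →* G := (MulAut.conj (a 0 ^ y 0)⁻¹).toMonoidHom
    have hc : ∀ x, c x = (a 0 ^ y 0)⁻¹ * x * a 0 ^ y 0 := fun x =>
      (MulAut.conj_apply _ _).trans (by rw [inv_inv])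
    have h₁ : c (normalWord (fun i => a i.succ) fun i => x i.succ) =
        normalWord (fun i => a i.succ) w₁ := by
      rw [← e₁, normalWord_succ, map_mul, hc, hconj, normalWord_eq_finRange_prod (n := k + 1),
        map_list_prod,
        List.map_map]
      congr 2
      refine List.map_congr_left fun i _ => ?_
      simp only [Function.comp_apply, hc, hconj]
    rw [normalWord_succ a (Fin.cons _ _)]
    simp only [Fin.cons_zero, Fin.cons_succ]
    rw [← e₂, ← h₁, hc, normalWord_succ a, normalWord_succ a y, zpow_add]
    group

lemma realizes_step
    (hD : ∀ {Q : Type u} [Group Q] (b : Fin (k + 2) → Q) (s : Triple (k + 2) → ℤ),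
      IsMalcevBasis b s → Realizes D b s)
    (ha : IsMalcevBasis a t) (hgen : Subgroup.closure (Set.range a) = ⊤) :
    Realizes (stepPolys D) a t := by
  obtain ⟨Q, _, π, hlast, hb⟩ := ha.exists_basisW hgen
  have hW := hD _ _ hb
  have hπ : ∀ x, π (normalWord a x) =
      normalWord (fun i => π (a i.castSucc)) fun i => x i.castSucc := by
    intro x
    rw [normalWord_castSucc, map_mul, map_zpow, hlast, one_zpow, mul_one, map_normalWord]
  have hmul : ∀ x y : Fin (k + 3) → ℤ, ∃ w : Fin (k + 3) → ℤ,
      (stepPolys D).mul (ratParam t) (ratVec x) (ratVec y) = ratVec w ∧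
        normalWord a x * normalWord a y = normalWord a w := by
    intro x y
    obtain ⟨w, hw, e⟩ := exists_mul hD ha hgen x y
    refine ⟨w, ?_, e⟩
    obtain ⟨w', hw', e'⟩ := hW.mul (fun i => x i.castSucc) (fun i => y i.castSucc)
    have h := congrArg π e
    rw [map_mul, hπ, hπ, hπ, e'] at h
    have h := hb.inj h
    funext i
    cases i using Fin.lastCases with
    | last =>
      refine Eq.trans ?_ hw.symm
      simp [Polys.mul, stepPolys, stepF]
    | cast i =>
      refine (subsF_stepF_castSucc D (ratParam t) (ratVec x) (ratVec y) i).trans ?_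
      refine (congrFun hw' i).trans ?_
      rw [h]
      rfl
  refine ⟨hmul, fun x z => ?_, exists_conj hD ha hgen⟩
  choose w hw using fun z : ℤ => ha.exists_word hgen (normalWord a x ^ z)
  refine ⟨w z, ?_, hw z⟩
  have hlow : ∀ z : ℤ, D.pow (paramW (ratParam t)) (fun i => ratVec x i.castSucc) (z : ℚ) =
      ratVec fun i => w z i.castSucc := by
    intro z
    obtain ⟨w', hw', e⟩ := hW.pow (fun i => x i.castSucc) z
    have h := congrArg π (hw z)
    rw [map_zpow, hπ, hπ, e] at h
    rw [← hb.inj h]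
    exact hw'
  funext i
  cases i using Fin.lastCases with
  | cast i =>
    have : (stepPolys D).K i.castSucc = lowK D i := by simp [stepPolys]
    rw [Polys.pow, this]
    exact (subsK_lowK D (ratParam t) (ratVec x) (z : ℚ) i).trans (congrFun (hlow z) i)
  | last =>
    have : (stepPolys D).K (Fin.last _) = newK D := by simp [stepPolys]
    rw [Polys.pow, this]
    refine (eq_eval₂_solveRec (MvPolynomial.eval₂Hom (param (ratParam t)) (ratVec x)) _
      (fun z => w z (Fin.last _)) ?_ (fun z => ?_) z).symm
    · have h0 := hw 0
      rw [zpow_zero, ← normalWord_zero a] at h0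
      exact (congrFun (ha.inj h0) _).symm
    · rw [subsK_step, hlow]
      obtain ⟨w', hw', e⟩ := exists_mul hD ha hgen
        (Fin.snoc (fun i => w z i.castSucc) 0 : Fin (k + 3) → ℤ) x
      have hvec : (Fin.snoc (ratVec fun i => w z i.castSucc) 0 : Fin (k + 3) → ℚ) =
          ratVec (Fin.snoc (fun i => w z i.castSucc) 0 : Fin (k + 3) → ℤ) := by
        funext i
        cases i using Fin.lastCases <;> simp [ratVec]
      rw [hvec, ← hw']
      -- The central factor `a_n` is split off the `z`-th power before the multiplication by the
      -- word for `x`; its exponent is simply added to the last exponent of the product.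
      have key : normalWord a (w (z + 1)) = normalWord a
          (Fin.snoc (fun i => w' i.castSucc) (w z (Fin.last _) + w' (Fin.last _)) :
            Fin (k + 3) → ℤ) := by
        have hcom := ((ha.commute_last hgen (normalWord a x)).zpow_left (w z (Fin.last _))).eq
        rw [normalWord_castSucc a (Fin.snoc _ _)] at e ⊢
        simp only [Fin.snoc_castSucc, Fin.snoc_last, zpow_zero, mul_one] at e ⊢
        rw [← hw, zpow_add, zpow_one, hw z, normalWord_castSucc, mul_assoc, hcom, ← mul_assoc, e,
          normalWord_castSucc a w', mul_assoc, ← zpow_add, add_comm (w' _)]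
      have h := congrFun (ha.inj key) (Fin.last _)
      rw [Fin.snoc_last] at h
      simp only [h]
      push_cast
      rfl

end Step

/-! ### The main theorem -/

section Main

universe u

lemma realizes_basePolys {G : Type u} [Group G] {n : ℕ} (hn : n ≤ 2) {a : Fin n → G}
    {t : Triple n → ℤ} (ha : IsMalcevBasis a t) : Realizes (basePolys n) a t := by
  have hcomm : ∀ i j, Commute (a i) (a j) := by
    have hlt : ∀ i j, i < j → Commute (a j) (a i) := by
      intro i j hij
      -- With at most two generators nothing follows `a j`, so the relations say that the generators
      -- commute.
      have h1 : tailWord a j (exps t hij) = 1 := by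
        have : ∀ l, ¬ j < l := fun l hl => by omega
        simp [tailWord, this]
      have := ha.rel i j hij
      rwa [h1, mul_one] at this
    intro i j
    rcases lt_trichotomy i j with h | rfl | h
    · exact (hlt i j h).symm
    · exact Commute.refl _
    · exact hlt j i h
  have hadd : ∀ {m : ℕ} (b : Fin m → G), (∀ i j, Commute (b i) (b j)) → ∀ x y : Fin m → ℤ,
      normalWord b x * normalWord b y = normalWord b (fun i => x i + y i) := by
    intro m b hb x y
    induction m with
    | zero => simp
    | succ m ih =>
      have h := ih (fun i => b i.succ) (fun i j => hb _ _) (fun i => x i.succ) (fun i => y i.succ)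
      have hc : Commute (normalWord (fun i => b i.succ) fun i => x i.succ) (b 0 ^ y 0) :=
        (Subgroup.mem_centralizer_singleton_iff.1 (normalWord_mem
          (K := Subgroup.centralizer {b 0 ^ y 0}) (fun i =>
            Subgroup.mem_centralizer_singleton_iff.2 ((hb _ _).zpow_right _)) _))
      rw [normalWord_succ b x, normalWord_succ b y, normalWord_succ b, ← h, zpow_add, mul_assoc,
        ← mul_assoc (normalWord _ _), hc.eq]
      simp only [mul_assoc]
  refine ⟨fun x y => ⟨fun i => x i + y i, ?_, hadd a hcomm x y⟩, fun x z =>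
    ⟨fun i => x i * z, ?_, ?_⟩, fun i j hij u v => ⟨0, fun l hjl => ?_, ?_⟩⟩
  · funext i
    simp [Polys.mul, basePolys, subsF, ratVec]
  · funext i
    simp [Polys.pow, basePolys, subsK, ratVec]
  · induction z using Int.induction_on with
    | zero => simp
    | succ i ih =>
      rw [zpow_add, ih, zpow_one, hadd a hcomm]
      simp only [mul_add, mul_one]
    | pred i ih =>
      rw [zpow_sub, ih, zpow_one, mul_inv_eq_iff_eq_mul, hadd a hcomm]
      simp only [mul_sub, mul_one, sub_add_cancel]
  · omega
  · have : tailWord a j 0 = 1 := by simp [tailWord]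
    rw [this, mul_one, ((hcomm j i).zpow_zpow u v).eq]

/-- The group is quantified inside the induction because the step also uses the hypothesis in the
quotient `W`. -/
theorem hallPolys_realizes (n : ℕ) : ∀ {G : Type u} [Group G] (a : Fin n → G)
    (t : Triple n → ℤ), IsMalcevBasis a t → Realizes (hallPolys n) a t := by
  induction n using hallPolys.induct with
  | case1 => exact fun a t ha => realizes_basePolys (by norm_num) ha
  | case2 => exact fun a t ha => realizes_basePolys (by norm_num) ha
  | case3 => exact fun a t ha => realizes_basePolys le_rfl ha
  | case4 k ih =>
    intro G _ a t ha
    -- The inductive step needs `a` to generate, for instance to know that `a_n` is central; hence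
    -- the passage to the generated subgroup and back.
    let S := Subgroup.closure (Set.range a)
    let a' : Fin (k + 3) → S := fun i => ⟨a i, Subgroup.subset_closure ⟨i, rfl⟩⟩
    have ha' : IsMalcevBasis a' t := IsMalcevBasis.of_comp S.subtype S.subtype_injective ha
    have hgen : Subgroup.closure (Set.range a') = ⊤ := by
      refine Subgroup.map_injective S.subtype_injective ?_
      rw [MonoidHom.map_closure, ← Set.range_comp, ← MonoidHom.range_eq_map, Subgroup.range_subtype]
      rfl
    exact (realizes_step (fun b s => ih b s) ha' hgen).map S.subtype

end Main

end HallPoly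

end

theorem mainTheorem3 (n : ℕ) :
    -- every `T`-group of Hirsch length `n` is some `G(t)` with `t` consistent
    (∀ (G : Type*) [Group G], HallPoly.IsTGroup G → HallPoly.HasHirschLength G n →
      ∃ t ∈ HallPoly.consistentSet n, Nonempty (HallPoly.NilGroup t ≃* G)) ∧
    -- more precisely, every basis through a central series is the image of some `a_1, …, a_n`
    (∀ (G : Type*) [Group G] (H : Fin (n + 1) → Subgroup G) (g : Fin n → G),
      HallPoly.IsCentralBasis H g →
      ∃ t ∈ HallPoly.consistentSet n, ∃ e : HallPoly.NilGroup t ≃* G,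
        ∀ i, e (HallPoly.gen t i) = g i) ∧
    ∀ t ∈ HallPoly.consistentSet n,
      -- normal forms in `G(t)`
      (∀ g : HallPoly.NilGroup t,
        ∃! x : Fin n → ℤ, g = HallPoly.normalWord (HallPoly.gen t) x) ∧
      -- multiplication
      (∀ x y : Fin n → ℤ, ∃ w : Fin n → ℤ,
        (∀ i, (w i : ℚ) = HallPoly.subsF ((HallPoly.hallPolys n).F i)
          (HallPoly.ratParam t) (HallPoly.ratVec x) (HallPoly.ratVec y)) ∧
        HallPoly.normalWord (HallPoly.gen t) x * HallPoly.normalWord (HallPoly.gen t) y =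
          HallPoly.normalWord (HallPoly.gen t) w) ∧
      -- powering
      (∀ (x : Fin n → ℤ) (z : ℤ), ∃ w : Fin n → ℤ,
        (∀ i, (w i : ℚ) = HallPoly.subsK ((HallPoly.hallPolys n).K i)
          (HallPoly.ratParam t) (HallPoly.ratVec x) (z : ℚ)) ∧
        HallPoly.normalWord (HallPoly.gen t) x ^ z =
          HallPoly.normalWord (HallPoly.gen t) w) ∧
      -- conjugation
      (∀ (i j : Fin n) (hij : i < j) (u v : ℤ), ∃ w : Fin n → ℤ,
        (∀ (k : Fin n) (hjk : j < k), (w k : ℚ) =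
          HallPoly.subsR ((HallPoly.hallPolys n).R ⟨i, j, k, hij, hjk⟩)
            (HallPoly.ratParam t) (u : ℚ) (v : ℚ)) ∧
        HallPoly.gen t j ^ u * HallPoly.gen t i ^ v =
          HallPoly.gen t i ^ v * HallPoly.gen t j ^ u *
            HallPoly.tailWord (HallPoly.gen t) j w) := by
  refine ⟨fun G _ hG hn => ?_, fun G _ H g h => h.exists_mulEquiv, fun t ht => ?_⟩
  · obtain ⟨H, g, h⟩ := hG.exists_centralBasis hn
    obtain ⟨t, ht, e, -⟩ := h.exists_mulEquiv
    exact ⟨t, ht, ⟨e⟩⟩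
  -- Consistency enters only here, through uniqueness of normal words in `G(t)`.
  · have hb := HallPoly.isCentralBasis_gen ht
    have ha : HallPoly.IsMalcevBasis (HallPoly.gen t) t :=
      ⟨HallPoly.satisfiesRelations_gen t, hb.normalWord_injective⟩
    have hR := HallPoly.hallPolys_realizes n _ t ha
    refine ⟨fun g => ?_, fun x y => ?_, fun x z => ?_, hR.conj⟩
    · obtain ⟨x, hx⟩ := ha.exists_word (HallPoly.closure_range_gen t) g
      exact ⟨x, hx, fun y hy => ha.inj (hy.symm.trans hx)⟩
    · obtain ⟨w, hw, e⟩ := hR.mul x y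
      exact ⟨w, fun i => (congrFun hw i).symm, e⟩
    · obtain ⟨w, hw, e⟩ := hR.pow x z
      exact ⟨w, fun i => (congrFun hw i).symm, e⟩
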